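/- Let $V$ be a finite set of sites. Each site $v$ carries a qudit of finite dimension $d_v\ge 1$ ($d_v=1$ meaning no qudit) and finitely many (possibly zero, even or odd) Majorana modes; in total there are $2n$ Majorana operators $\gamma_1,\gamma'_1,\dots,\gamma_n,\gamma'_n$ with the canonical anticommutation relations, represented irreducibly (Jordan–Wigner) on $(\mathbb C^2)^{\otimes n}$, so that the Hilbert space is $\bigotimes_v\mathbb C^{d_v}\otimes(\mathbb C^2)^{\otimes n}$. An operator is supported on a set $T$ of sites if it lies in the algebra generated by the Majorana operators and the qudit operators located at sites of $T$; it is even (odd) if it commutes (anticommutes) with $\prod_k\gamma_k\gamma'_k$. Let $G$ be a finite simple graph on $V$ (the interaction graph), and for every edge $\{i,j\}$ of $G$ let $P_{i,j}$ be an orthogonal projector of even fermion parity supported on $\{i,j\}$, such that all $P_{i,j}$ commute; the Hamiltonian is $H=\sum_{\{i,j\}}P_{i,j}$, the sum being over edges (unordered pairs). **Theorem.** There exist unitaries $U_{i,j}$ of even fermion parity supported on $\{i,j\}$, one for each edge of $G$, and orthogonal projectors $\Pi_i$ of even fermion parity supported on $\{i\}$, one for each site, such that: 1. The unitaries $U_{i,j}$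 mutually commute, and $U_{i,j}$ commutes with $P_{k,l}$ whenever $\{i,j\}\neq\{k,l\}$. 2. The conjugated Hamiltonian $\tilde H=\sum_{\{i,j\}}U_{i,j}^\dagger P_{i,j}U_{i,j}$ commutes with $\Pi_i$ for every $i$. 3. Some ground state of $\tilde H$ (a nonzero eigenvector for its smallest eigenvalue) lies in the common $+1$ eigenspace $\mathcal H_\Pi$ of all $\Pi_i$. For every edge, with its end points named $i,j$ in a suitable order, the restriction of $U_{i,j}^\dagger P_{i,j}U_{i,j}$ to $\mathcal H_\Pi$ is either $0$, or $1$, or $\frac12(1+i\,\tau_{j\to i}\tau_{i\to j})$. In the last case $\tau_{j\to i}$ is supported on $\{i\}$ and $\tau_{i\to j}$ on $\{j\}$; both are Hermitian, of odd fermion parity, and square to $1$ on the images of $\Pi_i$ and $\Pi_j$ respectively (that is, $\tau_{j\to i}=\Pi_i\tau_{j\to i}=\tau_{j\to i}\Pi_i$ and $\tau_{j\to i}^2=\Pi_i$, and likewise for $\tau_{i\to j}$ with $\Pi_j$). Any two of these operators belonging to different ordered pairs anticommute: $\{\tau_{i\to j},\tau_{k\to l}\}=0$ whenever both exist and $(i,j)\neq(k,l)$.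 In this sense the ground state is, up to conjugation by the commuting edge unitaries, a generalized Majorana chain. -/

import Mathlib

open scoped Matrix

/-- A finite fermionic lattice system: at each site `v` a qudit of dimension `d v ≥ 1`
(`d v = 1` means that there is no qudit; several qudits on one site are combined into one),
and `n` fermionic degrees of freedom, the `k`-th of which provides two Majorana operators `γ k` and
`γ' k`, located at the sites `siteγ k` and `siteγ' k`.  The two sites need not coincide, so
a site may carry any number of Majorana modes, even or odd. -/
structure FermionSystem (V : Type*) where
  d : V → ℕ
  d_pos : ∀ v, 0 < d v
  n : ℕ
  siteγ : Fin n → V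
  siteγ' : Fin n → V

namespace FermionSystem

variable {V : Type*}

/-- Labels of the standard basis of the Hilbert space `(⨂ v, ℂ ^ d v) ⊗ (ℂ ^ 2) ^ {⊗ n}`:
a basis state for each qudit and an occupation number for each fermionic degree of freedom. -/
abbrev Config (S : FermionSystem V) : Type _ := (∀ v, Fin (S.d v)) × (Fin S.n → Bool)

/-- State vectors. -/
abbrev State (S : FermionSystem V) : Type _ := S.Config → ℂ

/-- Operators on the Hilbert space, as matrices in the standard (orthonormal) basis. -/
abbrev Op (S : FermionSystem V) : Type _ := Matrix S.Config S.Config ℂ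

/-- The Jordan–Wigner sign `∏_{l < k} (-1) ^ {s l}`. -/
def jwSign (S : FermionSystem V) (k : Fin S.n) (s : Fin S.n → Bool) : ℂ :=
  ∏ l ∈ Finset.univ.filter (fun l => l < k), (if s l then -1 else 1)

variable [Fintype V] [DecidableEq V]

/-- The Majorana operator `γ k = a k + (a k)†`. -/
def γ (S : FermionSystem V) (k : Fin S.n) : S.Op := fun x y =>
  if x.1 = y.1 ∧ x.2 = Function.update y.2 k (!(y.2 k)) then S.jwSign k y.2 else 0

/-- The Majorana operator `γ' k = i ((a k)† - a k)`. -/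
def γ' (S : FermionSystem V) (k : Fin S.n) : S.Op := fun x y =>
  if x.1 = y.1 ∧ x.2 = Function.update y.2 k (!(y.2 k)) then
    (if y.2 k then -Complex.I else Complex.I) * S.jwSign k y.2 else 0

/-- The operator acting as the matrix `A` on the qudit at `v` and trivially on everything else. -/
def quditOp (S : FermionSystem V) (v : V) (A : Matrix (Fin (S.d v)) (Fin (S.d v)) ℂ) : S.Op :=
  fun x y => if x.2 = y.2 ∧ ∀ w, w ≠ v → x.1 w = y.1 w then A (x.1 v) (y.1 v) else 0

/-- The operators supported on a set `T` of sites: the algebra generated by the Majorana operators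
and the qudit operators located in `T`. -/
def localAlgebra (S : FermionSystem V) (T : Set V) : Subalgebra ℂ S.Op :=
  Algebra.adjoin ℂ
    ({O | ∃ k, S.siteγ k ∈ T ∧ O = S.γ k} ∪ {O | ∃ k, S.siteγ' k ∈ T ∧ O = S.γ' k} ∪
      {O | ∃ v ∈ T, ∃ A, O = S.quditOp v A})

/-- The product of `γ k * γ' k` over all fermionic degrees of freedom
(the fermion parity operator, up to a phase). -/
def parity (S : FermionSystem V) : S.Op := (List.ofFn fun k => S.γ k * S.γ' k).prod

/-- Even fermion parity. -/
def IsEven (S : FermionSystem V) (O : S.Op) : Prop := S.parity * O = O * S.parity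

/-- Odd fermion parity. -/
def IsOdd (S : FermionSystem V) (O : S.Op) : Prop := S.parity * O = -(O * S.parity)

/-- `ψ` is a ground state of `H`: an eigenvector for the smallest eigenvalue. -/
def IsGroundState (S : FermionSystem V) (H : S.Op) (ψ : S.State) : Prop :=
  ψ ≠ 0 ∧ ∃ E : ℝ, H *ᵥ ψ = (E : ℂ) • ψ ∧
    ∀ (E' : ℝ) (φ : S.State), φ ≠ 0 → H *ᵥ φ = (E' : ℂ) • φ → E ≤ E'

/-- The common `+1` eigenspace of a family of operators. -/
def plusEigenspace (S : FermionSystem V) (Q : V → S.Op) : Set S.State :=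
  {ψ | ∀ i, Q i *ᵥ ψ = ψ}

/-- The set of the two end points of an edge. -/
def ends {G : SimpleGraph V} (e : G.edgeSet) : Set V := {v | v ∈ (e : Sym2 V)}

end FermionSystem

/-! This is a graded version of the structure theory of commuting two-body Hamiltonians. Expand an
edge projector as `P e = ∑ x i * y i`, with factors at the two end points that are homogeneous and
linearly independent. If another edge `f` shares the site `v` with `e`, the commutator of `P f` with
`P e` is `∑ [P f, x i] * y i`, because the even operator `P f` commutes with the remote factors `y
i`. Independence of the `y i` makes each `P f` commute with each `x i`. The same argument applied to
the expansion of `P f` makes the factors of `f` at `v` supercommute with those of `e`. So every pair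
of an edge `e` and a site `v` has a graded star-algebra `N e v` inside the algebra of the site,
algebras of different pairs supercommute, and `P e` is built from the two algebras at its ends
(`exists_site_algebras`). The independence used here is that of a tensor product. For fermions it is
derived from the multiplicativity of the normalized trace on disjoint regions
(`trace_mul_labelAlgebra`, `eq_zero_of_sum_mul_eq_zero`).

The rest is finite-dimensional algebra. The unit of `N e v` splits into minimal even projections,
and the corner at each of them is spanned by the projection and at most one odd self-adjoint `τ`
squaring to it (`Matrix.exists_odd_corner`). On an edge, let `h` be the product of two such
projections, one at each end. In the even edge algebra the corner at `h` is spanned by `h` and `κ =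
i τ τ'`, so the eigenprojections of `κ` are minimal there. A product of reflections from that
algebra conjugates `P e` so that it commutes with all of them (`Matrix.exists_unitary_commute`). It
then acts on each minimal projection as `0` or `1`, hence below `h` as `0`, `h` or `(h ± κ) / 2`
(`exists_edge_unitary`).

Even elements of different edge algebras commute, so the edge unitaries do not disturb one another.
The conjugated Hamiltonian commutes with all the minimal projections. A ground state can therefore
be found in the range of one projection for each pair of an edge and a site. The product of the
selected projections at a site is `Q`, and the selected odd elements, cut down by `Q`, are the
Majorana operators of the chain. -/

namespace FermionSystem

/-! ### Jordan–Wigner matrices: anticommutation relations and qudit operators. -/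

/-- The matrix with exactly one nonzero entry per column, at the row `σ y` of the column `y`. -/
def monomialMatrix {C : Type*} [DecidableEq C] (σ : C → C) (f : C → ℂ) : Matrix C C ℂ :=
  fun x y => if x = σ y then f y else 0

theorem monomialMatrix_mul {C : Type*} [DecidableEq C] [Fintype C] (σ τ : C → C) (f g : C → ℂ) :
    monomialMatrix σ f * monomialMatrix τ g =
      monomialMatrix (σ ∘ τ) (fun y => f (τ y) * g y) := by
  ext x y
  simp [Matrix.mul_apply, monomialMatrix]

theorem monomialMatrix_neg {C : Type*} [DecidableEq C] (σ : C → C) (f : C → ℂ) :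
    -monomialMatrix σ f = monomialMatrix σ (fun y => -f y) := by
  ext x y
  by_cases h : x = σ y <;> simp [monomialMatrix, h]

theorem monomialMatrix_eq_one {C : Type*} [DecidableEq C] (σ : C → C) (f : C → ℂ)
    (hσ : ∀ y, σ y = y) (hf : ∀ y, f y = 1) : monomialMatrix σ f = 1 := by
  ext x y
  simp [monomialMatrix, hσ, hf, Matrix.one_apply]

theorem star_monomialMatrix {C : Type*} [DecidableEq C] (σ : C → C) (f : C → ℂ)
    (hσ : ∀ y, σ (σ y) = y) (hf : ∀ y, star (f y) = f (σ y)) :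
    star (monomialMatrix σ f) = monomialMatrix σ f := by
  ext x y
  rw [Matrix.star_apply]
  by_cases h : x = σ y
  · subst h
    simp [monomialMatrix, hσ, ← hf]
  · have : ¬ y = σ x := fun h' => h (by rw [h', hσ])
    simp [monomialMatrix, h, this]

variable {V : Type*}

/-- Change the occupation number of the `k`-th fermionic degree of freedom. -/
def flip (S : FermionSystem V) (k : Fin S.n) (y : S.Config) : S.Config :=
  (y.1, Function.update y.2 k (!(y.2 k)))

theorem flip_flip (S : FermionSystem V) (k : Fin S.n) (y : S.Config) :
    S.flip k (S.flip k y) = y := by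
  simp [flip]

theorem flip_comm (S : FermionSystem V) (k l : Fin S.n) (y : S.Config) :
    S.flip k (S.flip l y) = S.flip l (S.flip k y) := by
  rcases eq_or_ne k l with rfl | h
  · rfl
  · simp [flip, Function.update_of_ne h, Function.update_of_ne h.symm, Function.update_comm h]

/-- Only modes strictly before `k` enter the sign. For `k ≠ l` exactly one of the two strings sees
the other flip, and this single sign is the source of all anticommutation between different modes.
-/
theorem jwSign_flip (S : FermionSystem V) (k l : Fin S.n) (y : S.Config) :
    S.jwSign k (S.flip l y).2 = (if l < k then -1 else 1) * S.jwSign k y.2 := by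
  unfold jwSign flip
  split_ifs with h
  · rw [← Finset.mul_prod_erase _ _ (a := l) (by simpa using h),
      ← Finset.mul_prod_erase (Finset.univ.filter (fun l => l < k))
        (fun l => if y.2 l then (-1 : ℂ) else 1) (a := l) (by simpa using h)]
    have : ∀ m ∈ (Finset.univ.filter (fun l => l < k)).erase l,
        (if Function.update y.2 l (!(y.2 l)) m then (-1 : ℂ) else 1) =
          if y.2 m then -1 else 1 := by
      intro m hm
      rw [Function.update_of_ne (Finset.ne_of_mem_erase hm)]
    rw [Finset.prod_congr rfl this]
    cases y.2 l <;> simp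
  · rw [one_mul]
    refine Finset.prod_congr rfl fun m hm => ?_
    have : m ≠ l := by rintro rfl; simp at hm; exact h hm
    simp only [Function.update_of_ne this]

theorem jwSign_mul_self (S : FermionSystem V) (k : Fin S.n) (s : Fin S.n → Bool) :
    S.jwSign k s * S.jwSign k s = 1 := by
  unfold jwSign
  rw [← Finset.prod_mul_distrib]
  exact Finset.prod_eq_one fun l _ => by split_ifs <;> simp

theorem star_jwSign (S : FermionSystem V) (k : Fin S.n) (s : Fin S.n → Bool) :
    star (S.jwSign k s) = S.jwSign k s := by
  unfold jwSign
  rw [star_prod]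
  exact Finset.prod_congr rfl fun l _ => by split_ifs <;> simp

/-- The diagonal phase of the second Majorana operator. -/
def phase (S : FermionSystem V) (k : Fin S.n) (s : Fin S.n → Bool) : ℂ :=
  if s k then -Complex.I else Complex.I

theorem phase_flip_self (S : FermionSystem V) (k : Fin S.n) (y : S.Config) :
    S.phase k (S.flip k y).2 = -S.phase k y.2 := by
  cases h : y.2 k <;> simp [phase, flip, h]

theorem phase_flip_of_ne (S : FermionSystem V) {k l : Fin S.n} (h : k ≠ l) (y : S.Config) :
    S.phase k (S.flip l y).2 = S.phase k y.2 := by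
  simp [phase, flip, Function.update_of_ne h]

theorem phase_mul_self (S : FermionSystem V) (k : Fin S.n) (s : Fin S.n → Bool) :
    S.phase k s * S.phase k s = -1 := by
  unfold phase; split_ifs <;> simp

theorem star_phase (S : FermionSystem V) (k : Fin S.n) (s : Fin S.n → Bool) :
    star (S.phase k s) = -S.phase k s := by
  unfold phase; split_ifs <;> simp

variable [Fintype V] [DecidableEq V]

theorem γ_eq (S : FermionSystem V) (k : Fin S.n) :
    S.γ k = monomialMatrix (S.flip k) (fun y => S.jwSign k y.2) := by
  ext x y
  simp only [γ, monomialMatrix, flip, Prod.ext_iff]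

theorem γ'_eq (S : FermionSystem V) (k : Fin S.n) :
    S.γ' k = monomialMatrix (S.flip k) (fun y => S.phase k y.2 * S.jwSign k y.2) := by
  ext x y
  simp only [γ', monomialMatrix, flip, phase, Prod.ext_iff]

theorem γ_mul_self (S : FermionSystem V) (k : Fin S.n) : S.γ k * S.γ k = 1 := by
  rw [γ_eq, monomialMatrix_mul]
  refine monomialMatrix_eq_one _ _ (S.flip_flip k) fun y => ?_
  rw [jwSign_flip, if_neg (lt_irrefl k), one_mul, jwSign_mul_self]

theorem γ'_mul_self (S : FermionSystem V) (k : Fin S.n) : S.γ' k * S.γ' k = 1 := by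
  rw [γ'_eq, monomialMatrix_mul]
  refine monomialMatrix_eq_one _ _ (S.flip_flip k) fun y => ?_
  rw [jwSign_flip, if_neg (lt_irrefl k), phase_flip_self]
  linear_combination (-(S.phase k y.2 * S.phase k y.2)) * S.jwSign_mul_self k y.2
    - S.phase_mul_self k y.2

theorem star_γ (S : FermionSystem V) (k : Fin S.n) : star (S.γ k) = S.γ k := by
  rw [γ_eq]
  refine star_monomialMatrix _ _ (S.flip_flip k) fun y => ?_
  rw [jwSign_flip, if_neg (lt_irrefl k), one_mul, star_jwSign]

theorem star_γ' (S : FermionSystem V) (k : Fin S.n) : star (S.γ' k) = S.γ' k := by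
  rw [γ'_eq]
  refine star_monomialMatrix _ _ (S.flip_flip k) fun y => ?_
  rw [jwSign_flip, if_neg (lt_irrefl k), one_mul, star_mul, star_jwSign, star_phase,
    phase_flip_self]
  ring

/-- The underlying flips commute, so anticommutation reduces to a pointwise identity between the
coefficients. -/
theorem monomialMatrix_flip_anticomm (S : FermionSystem V) (k l : Fin S.n) (f g : S.Config → ℂ)
    (h : ∀ y, f (S.flip l y) * g y = -(g (S.flip k y) * f y)) :
    monomialMatrix (S.flip k) f * monomialMatrix (S.flip l) g =
      -(monomialMatrix (S.flip l) g * monomialMatrix (S.flip k) f) := by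
  rw [monomialMatrix_mul, monomialMatrix_mul, monomialMatrix_neg]
  congr 1
  · funext y; exact S.flip_comm k l y
  · funext y; exact h y

theorem γ_anticomm (S : FermionSystem V) {k l : Fin S.n} (h : k ≠ l) :
    S.γ k * S.γ l = -(S.γ l * S.γ k) := by
  rw [γ_eq, γ_eq]
  refine S.monomialMatrix_flip_anticomm k l _ _ fun y => ?_
  simp only [jwSign_flip]
  rcases lt_or_gt_of_ne h with h | h <;> simp [h, h.not_gt] <;> ring

theorem γ_anticomm_γ' (S : FermionSystem V) (k l : Fin S.n) :
    S.γ k * S.γ' l = -(S.γ' l * S.γ k) := by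
  rw [γ_eq, γ'_eq]
  refine S.monomialMatrix_flip_anticomm k l _ _ fun y => ?_
  rcases eq_or_ne k l with rfl | h
  · simp only [jwSign_flip, phase_flip_self]
    simp; ring
  · simp only [jwSign_flip, S.phase_flip_of_ne h.symm]
    rcases lt_or_gt_of_ne h with h | h <;> simp [h, h.not_gt] <;> ring

theorem γ'_anticomm (S : FermionSystem V) {k l : Fin S.n} (h : k ≠ l) :
    S.γ' k * S.γ' l = -(S.γ' l * S.γ' k) := by
  rw [γ'_eq, γ'_eq]
  refine S.monomialMatrix_flip_anticomm k l _ _ fun y => ?_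
  simp only [jwSign_flip, S.phase_flip_of_ne h, S.phase_flip_of_ne h.symm]
  rcases lt_or_gt_of_ne h with h | h <;> simp [h, h.not_gt] <;> ring

/-- The coefficient `f` depends on the occupation numbers alone, which a qudit operator does not
change. Each matrix product then has a single nonzero term, at the flipped configuration. -/
theorem quditOp_comm_monomialMatrix (S : FermionSystem V) (v : V)
    (A : Matrix (Fin (S.d v)) (Fin (S.d v)) ℂ) (k : Fin S.n) (f : (Fin S.n → Bool) → ℂ) :
    S.quditOp v A * monomialMatrix (S.flip k) (fun y => f y.2) =
      monomialMatrix (S.flip k) (fun y => f y.2) * S.quditOp v A := by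
  ext x y
  rw [Matrix.mul_apply, Matrix.mul_apply, Finset.sum_eq_single (S.flip k y),
    Finset.sum_eq_single (S.flip k x)]
  · have key : x.2 = (S.flip k y).2 ↔ (S.flip k x).2 = y.2 := by
      simp only [flip]
      constructor
      · intro h; rw [h]; simp
      · intro h; rw [← h]; simp
    simp only [quditOp, monomialMatrix, if_true, flip_flip]
    by_cases h : x.2 = (S.flip k y).2
    · have h' := key.1 h
      rw [h']
      simp only [h, true_and]
      exact mul_comm _ _
    · rw [if_neg (fun H => h H.1), if_neg (fun H => h (key.2 H.1)), zero_mul, mul_zero]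
  · intro z _ hz
    have : ¬ x = S.flip k z := fun h => hz (by rw [h, flip_flip])
    simp [monomialMatrix, this]
  · simp
  · intro z _ hz
    simp [monomialMatrix, hz]
  · simp

theorem quditOp_comm_γ (S : FermionSystem V) (v : V)
    (A : Matrix (Fin (S.d v)) (Fin (S.d v)) ℂ) (k : Fin S.n) :
    S.quditOp v A * S.γ k = S.γ k * S.quditOp v A := by
  rw [γ_eq]
  exact S.quditOp_comm_monomialMatrix v A k (S.jwSign k)

theorem quditOp_comm_γ' (S : FermionSystem V) (v : V)
    (A : Matrix (Fin (S.d v)) (Fin (S.d v)) ℂ) (k : Fin S.n) :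
    S.quditOp v A * S.γ' k = S.γ' k * S.quditOp v A := by
  rw [γ'_eq]
  exact S.quditOp_comm_monomialMatrix v A k (fun s => S.phase k s * S.jwSign k s)

theorem quditOp_mul_apply (S : FermionSystem V) (v : V)
    (A : Matrix (Fin (S.d v)) (Fin (S.d v)) ℂ) (O : S.Op) (x y : S.Config) :
    (S.quditOp v A * O) x y =
      ∑ a, A (x.1 v) a * O (Function.update x.1 v a, x.2) y := by
  rw [Matrix.mul_apply]
  symm
  refine Finset.sum_of_injOn (fun a => (Function.update x.1 v a, x.2)) ?_ ?_ ?_ ?_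
  · intro a _ b _ h
    simpa using congrFun (congrArg Prod.fst h) v
  · intro a _; simp
  · intro z _ hz
    have : ¬ (x.2 = z.2 ∧ ∀ w, w ≠ v → x.1 w = z.1 w) := by
      rintro ⟨h1, h2⟩
      refine hz ⟨z.1 v, by simp, ?_⟩
      refine Prod.ext (funext fun w => ?_) h1
      rcases eq_or_ne w v with rfl | hw
      · simp
      · simp [Function.update_of_ne hw, h2 w hw]
    simp [quditOp, this]
  · intro a _
    have : ∀ w, w ≠ v → x.1 w = Function.update x.1 v a w := fun w hw => by
      rw [Function.update_of_ne hw]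
    simp only [quditOp]
    rw [if_pos ⟨trivial, this⟩, Function.update_self]

theorem quditOp_mul (S : FermionSystem V) (v : V)
    (A B : Matrix (Fin (S.d v)) (Fin (S.d v)) ℂ) :
    S.quditOp v (A * B) = S.quditOp v A * S.quditOp v B := by
  ext x y
  rw [quditOp_mul_apply]
  have : ∀ a, (∀ w, w ≠ v → Function.update x.1 v a w = y.1 w) ↔
      ∀ w, w ≠ v → x.1 w = y.1 w := fun a =>
    forall_congr' fun w => forall_congr' fun hw => by rw [Function.update_of_ne hw]
  simp only [quditOp, this, Function.update_self]
  split_ifs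
  · rw [Matrix.mul_apply]
  · simp

theorem quditOp_one (S : FermionSystem V) (v : V) : S.quditOp v 1 = 1 := by
  ext x y
  simp only [quditOp, Matrix.one_apply]
  rw [← ite_and]
  refine if_congr ⟨fun ⟨⟨h1, h2⟩, h3⟩ => Prod.ext (funext fun w => ?_) h1, ?_⟩ rfl rfl
  · rcases eq_or_ne w v with rfl | hw
    · exact h3
    · exact h2 w hw
  · rintro rfl; simp

theorem star_quditOp (S : FermionSystem V) (v : V)
    (A : Matrix (Fin (S.d v)) (Fin (S.d v)) ℂ) :
    star (S.quditOp v A) = S.quditOp v (star A) := by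
  ext x y
  rw [Matrix.star_apply]
  simp only [quditOp, Matrix.star_apply]
  rw [apply_ite star, star_zero]
  exact if_congr (by simp only [eq_comm]) rfl rfl

/-- The matrix algebra of the qudit at `v`, as a subalgebra of all operators. -/
def quditHom (S : FermionSystem V) (v : V) :
    Matrix (Fin (S.d v)) (Fin (S.d v)) ℂ →ₐ[ℂ] S.Op :=
  AlgHom.ofLinearMap
    { toFun := S.quditOp v
      map_add' := fun A B => by
        ext x y
        simp only [quditOp, Matrix.add_apply]
        split_ifs <;> simp
      map_smul' := fun c A => by
        ext x y
        simp only [quditOp, Matrix.smul_apply, RingHom.id_apply]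
        split_ifs <;> simp }
    (S.quditOp_one v) (fun A B => S.quditOp_mul v A B)

theorem quditHom_apply (S : FermionSystem V) (v : V)
    (A : Matrix (Fin (S.d v)) (Fin (S.d v)) ℂ) : S.quditHom v A = S.quditOp v A := rfl

theorem quditOp_mul_quditOp_apply (S : FermionSystem V) {v w : V} (h : v ≠ w)
    (A : Matrix (Fin (S.d v)) (Fin (S.d v)) ℂ) (B : Matrix (Fin (S.d w)) (Fin (S.d w)) ℂ)
    (x y : S.Config) :
    (S.quditOp v A * S.quditOp w B) x y =
      if x.2 = y.2 ∧ ∀ u, u ≠ v → u ≠ w → x.1 u = y.1 u then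
        A (x.1 v) (y.1 v) * B (x.1 w) (y.1 w) else 0 := by
  rw [quditOp_mul_apply, Finset.sum_eq_single (y.1 v)]
  · simp only [quditOp, Function.update_of_ne h.symm, mul_ite, mul_zero]
    refine if_congr (and_congr_right fun _ => ?_) rfl rfl
    constructor
    · intro H u hv hw
      simpa [Function.update_of_ne hv] using H u hw
    · intro H u hw
      rcases eq_or_ne u v with rfl | hv
      · simp
      · simpa [Function.update_of_ne hv] using H u hv hw
  · intro a _ ha
    have : ¬ ∀ u, u ≠ w → Function.update x.1 v a u = y.1 u := fun H => ha (by
      simpa using H v h)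
    simp [quditOp, this]
  · simp

theorem quditOp_comm (S : FermionSystem V) {v w : V} (h : v ≠ w)
    (A : Matrix (Fin (S.d v)) (Fin (S.d v)) ℂ) (B : Matrix (Fin (S.d w)) (Fin (S.d w)) ℂ) :
    S.quditOp v A * S.quditOp w B = S.quditOp w B * S.quditOp v A := by
  ext x y
  rw [S.quditOp_mul_quditOp_apply h, S.quditOp_mul_quditOp_apply h.symm]
  refine if_congr (and_congr_right fun _ => ?_) (mul_comm _ _) rfl
  exact forall_congr' fun u => forall_comm

end FermionSystem

/-! ### Graded commutation and generated subalgebras. -/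

section Graded

variable {A : Type*} [Ring A] [Algebra ℂ A] [StarRing A] [StarModule ℂ A]

/-- Graded commutation with respect to an involutive automorphism `α` whose `+1` and `-1`
eigenspaces are the even and the odd elements. -/
def SuperCommute (α : A ≃⋆ₐ[ℂ] A) (S T : Set A) : Prop :=
  ∀ x ∈ S, ∀ y ∈ T, (α x = x → x * y = y * x) ∧ (α x = -x → x * y = α y * x)

variable {α : A ≃⋆ₐ[ℂ] A} {S T S' T' X Y : Set A}

theorem SuperCommute.mono (h : SuperCommute α S T) (hS : S' ⊆ S) (hT : T' ⊆ T) :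
    SuperCommute α S' T' := fun x hx y hy => h x (hS hx) y (hT hy)

theorem starAlgEquiv_algebraMap (α : A ≃⋆ₐ[ℂ] A) (c : ℂ) :
    α (algebraMap ℂ A c) = algebraMap ℂ A c := by
  rw [Algebra.algebraMap_eq_smul_one, map_smul, map_one]

/-- Writing the sign rule as `x * y = α y * x` requires no homogeneity of `y`. Both sides are
additive in `y` and compatible with products, so the rule passes from generators to the whole
algebra. -/
theorem SuperCommute.adjoin_right (h : SuperCommute α S Y) :
    SuperCommute α S (Algebra.adjoin ℂ Y) := by
  intro x hx y hy
  constructor <;> intro hα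
  · induction hy using Algebra.adjoin_induction with
    | mem y hy => exact (h x hx y hy).1 hα
    | algebraMap c => exact (Algebra.commutes c x).symm
    | add y z _ _ hy hz => rw [mul_add, add_mul, hy, hz]
    | mul y z _ _ hy hz => rw [← mul_assoc, hy, mul_assoc, hz, mul_assoc]
  · induction hy using Algebra.adjoin_induction with
    | mem y hy => exact (h x hx y hy).2 hα
    | algebraMap c => rw [starAlgEquiv_algebraMap]; exact (Algebra.commutes c x).symm
    | add y z _ _ hy hz => rw [mul_add, map_add, add_mul, hy, hz]
    | mul y z _ _ hy hz => rw [← mul_assoc, hy, mul_assoc, hz, map_mul, mul_assoc]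

theorem SuperCommute.symm_of_homogeneous (h : SuperCommute α S T)
    (hS : ∀ x ∈ S, α x = x ∨ α x = -x) : SuperCommute α T S := by
  intro y hy x hx
  obtain ⟨h0, h1⟩ := h x hx y hy
  constructor <;> intro hα
  · rcases hS x hx with hx | hx
    · exact (h0 hx).symm
    · rw [h1 hx, hα]
  · rcases hS x hx with hx | hx
    · rw [← h0 hx, hx]
    · rw [hx, neg_mul, h1 hx, hα, neg_mul, neg_neg]

/-- The even part of an element. -/
noncomputable def evenPart (α : A ≃⋆ₐ[ℂ] A) (x : A) : A := (1 / 2 : ℂ) • (x + α x)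

/-- The odd part of an element. -/
noncomputable def oddPart (α : A ≃⋆ₐ[ℂ] A) (x : A) : A := (1 / 2 : ℂ) • (x - α x)

theorem evenPart_add_oddPart (x : A) : evenPart α x + oddPart α x = x := by
  rw [evenPart, oddPart, ← smul_add, add_add_sub_cancel, ← two_smul ℂ x, smul_smul]
  norm_num

theorem map_evenPart (hα : ∀ x, α (α x) = x) (x : A) : α (evenPart α x) = evenPart α x := by
  rw [evenPart, map_smul, map_add, hα, add_comm]

theorem map_oddPart (hα : ∀ x, α (α x) = x) (x : A) : α (oddPart α x) = -oddPart α x := by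
  rw [oddPart, map_smul, map_sub, hα, ← smul_neg, neg_sub]

theorem evenPart_mem {B : Submodule ℂ A} (hB : ∀ x ∈ B, α x ∈ B) {x : A} (hx : x ∈ B) :
    evenPart α x ∈ B := B.smul_mem _ (B.add_mem hx (hB x hx))

theorem oddPart_mem {B : Submodule ℂ A} (hB : ∀ x ∈ B, α x ∈ B) {x : A} (hx : x ∈ B) :
    oddPart α x ∈ B := B.smul_mem _ (B.sub_mem hx (hB x hx))

theorem evenPart_of_even {x : A} (hx : α x = x) : evenPart α x = x := by
  rw [evenPart, hx, ← two_smul ℂ x, smul_smul]; norm_num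

theorem SuperCommute.symm_of_stable {B : Submodule ℂ A} (hα : ∀ x, α (α x) = x)
    (h : SuperCommute α B T) (hB : ∀ x ∈ B, α x ∈ B) : SuperCommute α T B := by
  intro y hy x hx
  have h0 := (h _ (evenPart_mem hB hx) y hy).1 (map_evenPart hα x)
  have h1 := (h _ (oddPart_mem hB hx) y hy).2 (map_oddPart hα x)
  have hx' := evenPart_add_oddPart (α := α) x
  constructor <;> intro hy'
  · rw [← hx', mul_add, add_mul, h0, h1, hy']
  · rw [← hx', mul_add, map_add, add_mul, map_evenPart hα, map_oddPart hα, h0, neg_mul, h1, hy']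
    simp

theorem adjoin_stable (hX : ∀ x ∈ X, α x = x ∨ α x = -x) :
    ∀ x ∈ Algebra.adjoin ℂ X, α x ∈ Algebra.adjoin ℂ X := by
  intro x hx
  induction hx using Algebra.adjoin_induction with
  | mem x hx =>
    rcases hX x hx with h | h <;> rw [h]
    · exact Algebra.subset_adjoin hx
    · exact neg_mem (Algebra.subset_adjoin hx)
  | algebraMap c => rw [starAlgEquiv_algebraMap]; exact algebraMap_mem _ c
  | add x y _ _ hx hy => rw [map_add]; exact add_mem hx hy
  | mul x y _ _ hx hy => rw [map_mul]; exact mul_mem hx hy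

/-- The relation extends on the right only, so the two sides are exchanged twice. The first exchange
uses homogeneous generators; the second uses that an `α`-stable algebra contains the even and odd
parts of its elements. -/
theorem SuperCommute.adjoin (hα : ∀ x, α (α x) = x) (h : SuperCommute α X Y)
    (hX : ∀ x ∈ X, α x = x ∨ α x = -x) (hY : ∀ x ∈ Y, α x = x ∨ α x = -x) :
    SuperCommute α (Algebra.adjoin ℂ X) (Algebra.adjoin ℂ Y) :=
  SuperCommute.symm_of_stable (B := Subalgebra.toSubmodule (Algebra.adjoin ℂ Y)) hα
    (h.adjoin_right.symm_of_homogeneous hX).adjoin_right (adjoin_stable hY)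

/-- Two supercommuting graded subalgebras generate the span of their products. -/
theorem SuperCommute.sup_le_mul {B C : Subalgebra ℂ A} (hα : ∀ x, α (α x) = x)
    (h : SuperCommute α (B : Set A) C) (hB : ∀ x ∈ B, α x ∈ B) (hC : ∀ x ∈ C, α x ∈ C) :
    Subalgebra.toSubmodule (B ⊔ C) ≤ Subalgebra.toSubmodule B * Subalgebra.toSubmodule C := by
  have hCB : Subalgebra.toSubmodule C * Subalgebra.toSubmodule B ≤
      Subalgebra.toSubmodule B * Subalgebra.toSubmodule C := by
    rw [Submodule.mul_le]
    intro c hc b hb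
    have h0 := (h _ (evenPart_mem (B := Subalgebra.toSubmodule B) hB hb) c hc).1
      (map_evenPart hα b)
    -- Using `α c` in place of `c` turns the rule round, since `α` is an involution: `c` moves past
    -- the odd part of `b` and becomes `α c`.
    have h1 := (h _ (oddPart_mem (B := Subalgebra.toSubmodule B) hB hb) (α c) (hC c hc)).2
      (map_oddPart hα b)
    rw [hα] at h1
    rw [← evenPart_add_oddPart (α := α) b, mul_add, ← h0, ← h1]
    exact add_mem
      (Submodule.mul_mem_mul (evenPart_mem (B := Subalgebra.toSubmodule B) hB hb) hc)
      (Submodule.mul_mem_mul (oddPart_mem (B := Subalgebra.toSubmodule B) hB hb) (hC c hc))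
  have hmul : ∀ x y, x ∈ Subalgebra.toSubmodule B * Subalgebra.toSubmodule C →
      y ∈ Subalgebra.toSubmodule B * Subalgebra.toSubmodule C →
      x * y ∈ Subalgebra.toSubmodule B * Subalgebra.toSubmodule C := by
    intro x y hx hy
    have := Submodule.mul_mem_mul hx hy
    rw [mul_assoc, ← mul_assoc (Subalgebra.toSubmodule C)] at this
    have h2 : Subalgebra.toSubmodule B *
        (Subalgebra.toSubmodule C * Subalgebra.toSubmodule B * Subalgebra.toSubmodule C) ≤
        Subalgebra.toSubmodule B * Subalgebra.toSubmodule C := by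
      calc _ ≤ Subalgebra.toSubmodule B *
            (Subalgebra.toSubmodule B * Subalgebra.toSubmodule C * Subalgebra.toSubmodule C) := by
            gcongr
        _ = (Subalgebra.toSubmodule B * Subalgebra.toSubmodule B) *
            (Subalgebra.toSubmodule C * Subalgebra.toSubmodule C) := by simp only [mul_assoc]
        _ ≤ _ := by
          gcongr <;> rw [Submodule.mul_le]
          · exact fun a ha b hb => mul_mem (S := Subalgebra ℂ A) ha hb
          · exact fun a ha b hb => mul_mem (S := Subalgebra ℂ A) ha hb
    exact h2 this
  have hone : (1 : A) ∈ Subalgebra.toSubmodule B * Subalgebra.toSubmodule C := by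
    simpa using Submodule.mul_mem_mul (M := Subalgebra.toSubmodule B)
      (N := Subalgebra.toSubmodule C) (one_mem B) (one_mem C)
  have : B ⊔ C ≤ (Subalgebra.toSubmodule B * Subalgebra.toSubmodule C).toSubalgebra hone hmul := by
    refine sup_le ?_ ?_
    · intro b hb
      simpa using Submodule.mul_mem_mul (M := Subalgebra.toSubmodule B)
        (N := Subalgebra.toSubmodule C) hb (one_mem C)
    · intro c hc
      simpa using Submodule.mul_mem_mul (M := Subalgebra.toSubmodule B)
        (N := Subalgebra.toSubmodule C) (one_mem B) hc
  exact this

theorem adjoin_star_mem (hX : ∀ x ∈ X, star x ∈ X) :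
    ∀ x ∈ Algebra.adjoin ℂ X, star x ∈ Algebra.adjoin ℂ X := by
  intro x hx
  induction hx using Algebra.adjoin_induction with
  | mem x hx => exact Algebra.subset_adjoin (hX x hx)
  | algebraMap c => rw [← algebraMap_star_comm]; exact algebraMap_mem _ _
  | add x y _ _ hx hy => rw [star_add]; exact add_mem hx hy
  | mul x y _ _ hx hy => rw [star_mul]; exact mul_mem hy hx

end Graded

section Graded

variable {A : Type*} [Ring A] [Algebra ℂ A] [StarRing A] [StarModule ℂ A] {α : A ≃⋆ₐ[ℂ] A}

theorem eq_zero_of_even_of_odd {x : A} (h0 : α x = x) (h1 : α x = -x) : x = 0 := by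
  have : x = evenPart α x := (evenPart_of_even h0).symm
  rw [this, evenPart, h1, add_neg_cancel, smul_zero]

/-- The clause for even `x` costs nothing, since an element that is both even and odd vanishes. -/
theorem superCommute_pair_of_odd {x y : A} (hx : α x = -x) (hy : α y = -y)
    (h : x * y = -(y * x)) : (α x = x → x * y = y * x) ∧ (α x = -x → x * y = α y * x) := by
  refine ⟨fun h0 => ?_, fun _ => by rw [h, hy, neg_mul]⟩
  rw [eq_zero_of_even_of_odd h0 hx, zero_mul, mul_zero]

theorem superCommute_pair_of_right_even {x y : A} (hy : α y = y)
    (h : x * y = y * x) : (α x = x → x * y = y * x) ∧ (α x = -x → x * y = α y * x) :=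
  ⟨fun _ => h, fun _ => by rw [h, hy]⟩

theorem superCommute_pair_of_left_even {x y : A} (hx : α x = x)
    (h : x * y = y * x) : (α x = x → x * y = y * x) ∧ (α x = -x → x * y = α y * x) :=
  ⟨fun _ => h, fun h1 => by rw [eq_zero_of_even_of_odd hx h1, zero_mul, mul_zero]⟩

end Graded

/-! ### The parity grading and the factorization of the trace. -/

theorem List.prod_ofFn_mul_of_mul_eq_smul {A : Type*} [Ring A] [Algebra ℂ A] {n : ℕ}
    (f : Fin n → A) (s : Fin n → ℂ) (x : A) (h : ∀ k, f k * x = s k • (x * f k)) :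
    (List.ofFn f).prod * x = (∏ k, s k) • (x * (List.ofFn f).prod) := by
  induction n with
  | zero => simp
  | succ n ih =>
    rw [List.ofFn_succ, List.prod_cons, Fin.prod_univ_succ, mul_assoc,
      ih (fun k => f k.succ) (fun k => s k.succ) (fun k => h k.succ), mul_smul_comm, ← mul_assoc,
      h, smul_mul_assoc, smul_smul, mul_assoc, mul_comm (s 0)]

theorem List.prod_ofFn_mul_self {A : Type*} [Ring A] [Algebra ℂ A] {n : ℕ}
    (f : Fin n → A) (hc : ∀ k l, f k * f l = f l * f k) (h : ∀ k, f k * f k = -1) :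
    (List.ofFn f).prod * (List.ofFn f).prod = (-1 : ℂ) ^ n • (1 : A) := by
  induction n with
  | zero => simp
  | succ n ih =>
    have h1 := List.prod_ofFn_mul_of_mul_eq_smul (fun k : Fin n => f k.succ) (fun _ => 1) (f 0)
      (fun k => by rw [one_smul, hc])
    simp only [Finset.prod_const_one, one_smul] at h1
    rw [List.ofFn_succ, List.prod_cons, mul_assoc, ← mul_assoc _ (f 0), h1, mul_assoc, ← mul_assoc,
      h, ih (fun k => f k.succ) (fun k l => hc _ _) (fun k => h _), pow_succ]
    simp

namespace Matrix

/-- Uniqueness of the trace, without division. An off-diagonal unit is `E_ii E_ij` while `E_ij E_ii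
= 0`, so `f` kills it; the diagonal units `E_ij E_ji` and `E_ji E_ij` have equal values. -/
theorem card_smul_tracial {m : Type*} [Fintype m] [DecidableEq m] (f : Matrix m m ℂ →ₗ[ℂ] ℂ)
    (hf : ∀ A B, f (A * B) = f (B * A)) (A : Matrix m m ℂ) :
    (Fintype.card m : ℂ) * f A = A.trace * f 1 := by
  have hoff : ∀ i j, i ≠ j → f (Matrix.single i j 1) = 0 := by
    intro i j hij
    have := hf (Matrix.single i i 1) (Matrix.single i j 1)
    rw [Matrix.single_mul_single_same, Matrix.single_mul_single_of_ne _ _ _ _ hij.symm] at this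
    simpa using this
  have hdiag : ∀ i j, f (Matrix.single i i 1) = f (Matrix.single j j 1) := by
    intro i j
    have := hf (Matrix.single i j 1) (Matrix.single j i 1)
    simpa [Matrix.single_mul_single_same] using this
  have hone : ∀ i, f 1 = Fintype.card m * f (Matrix.single i i 1) := by
    intro i
    conv_lhs => rw [Matrix.matrix_eq_sum_single (1 : Matrix m m ℂ)]
    simp only [map_sum]
    rw [Finset.sum_congr rfl (g := fun _ => f (Matrix.single i i 1))]
    · simp
    · intro j _
      rw [Finset.sum_eq_single j]
      · rw [Matrix.one_apply_eq, hdiag]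
      · intro k _ hk
        rw [Matrix.one_apply_ne hk.symm]; simp
      · simp
  conv_lhs => rw [Matrix.matrix_eq_sum_single A]
  simp only [map_sum, Matrix.trace, Finset.sum_mul, Finset.mul_sum, Matrix.diag]
  refine Finset.sum_congr rfl fun i _ => ?_
  have hs : ∀ j, f (Matrix.single i j (A i j)) = A i j * f (Matrix.single i j 1) := by
    intro j
    rw [← smul_eq_mul, ← map_smul, Matrix.smul_single, smul_eq_mul, mul_one]
  rw [Finset.sum_eq_single i]
  · rw [hs, hone i]; ring
  · intro j _ hj
    rw [hs, hoff _ _ hj.symm]; simp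
  · simp

end Matrix

namespace FermionSystem

variable {V : Type*} [Fintype V] [DecidableEq V]

theorem γ_mul_γ'_mul_self (S : FermionSystem V) (k : Fin S.n) :
    (S.γ k * S.γ' k) * (S.γ k * S.γ' k) = -1 := by
  rw [S.γ_anticomm_γ' k k, neg_mul_neg, mul_assoc, ← mul_assoc (S.γ k), S.γ_anticomm_γ' k k,
    neg_mul, mul_assoc, S.γ_mul_self, mul_one, mul_neg, S.γ'_mul_self]

theorem pair_mul_of_anticomm {A : Type*} [Ring A] {a b x : A} (ha : a * x = -(x * a))
    (hb : b * x = -(x * b)) : (a * b) * x = x * (a * b) := by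
  rw [mul_assoc, hb, mul_neg, ← mul_assoc, ha, neg_mul, neg_neg, mul_assoc]

theorem parity_mul_of (S : FermionSystem V) (l : Fin S.n) (x : S.Op)
    (h : ∀ k, k ≠ l → (S.γ k * S.γ' k) * x = x * (S.γ k * S.γ' k))
    (hl : (S.γ l * S.γ' l) * x = -(x * (S.γ l * S.γ' l))) :
    S.parity * x = -(x * S.parity) := by
  have := List.prod_ofFn_mul_of_mul_eq_smul (fun k => S.γ k * S.γ' k)
    (fun k => if k = l then -1 else 1) x (fun k => by
      by_cases hk : k = l
      · subst hk; simpa using hl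
      · simpa [hk] using h k hk)
  simpa [parity] using this

theorem parity_mul_γ (S : FermionSystem V) (l : Fin S.n) :
    S.parity * S.γ l = -(S.γ l * S.parity) := by
  refine S.parity_mul_of l _ (fun k hk => ?_) ?_
  · exact pair_mul_of_anticomm (S.γ_anticomm hk) (by rw [S.γ_anticomm_γ' l k, neg_neg])
  · rw [mul_assoc, ← mul_neg, S.γ_anticomm_γ' l l, neg_neg]

theorem parity_mul_γ' (S : FermionSystem V) (l : Fin S.n) :
    S.parity * S.γ' l = -(S.γ' l * S.parity) := by
  refine S.parity_mul_of l _ (fun k hk => ?_) ?_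
  · exact pair_mul_of_anticomm (S.γ_anticomm_γ' k l) (S.γ'_anticomm hk)
  · rw [S.γ_anticomm_γ' l l, neg_mul, mul_assoc, S.γ_anticomm_γ' l l, mul_neg]

theorem parity_mul_quditOp (S : FermionSystem V) (v : V)
    (B : Matrix (Fin (S.d v)) (Fin (S.d v)) ℂ) :
    S.parity * S.quditOp v B = S.quditOp v B * S.parity := by
  have := List.prod_ofFn_mul_of_mul_eq_smul (fun k => S.γ k * S.γ' k)
    (fun k => 1) (S.quditOp v B) (fun k => by
      rw [one_smul, mul_assoc, ← S.quditOp_comm_γ', ← mul_assoc, ← S.quditOp_comm_γ, mul_assoc])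
  simpa [parity] using this

theorem parity_mem_unitary (S : FermionSystem V) : S.parity ∈ unitary S.Op := by
  refine Submonoid.list_prod_mem _ fun x hx => ?_
  obtain ⟨k, rfl⟩ := (List.mem_ofFn' _ _).1 hx
  rw [Unitary.mem_iff, star_mul, S.star_γ, S.star_γ']
  constructor
  · rw [mul_assoc, ← mul_assoc (S.γ k), S.γ_mul_self, one_mul, S.γ'_mul_self]
  · rw [mul_assoc, ← mul_assoc (S.γ' k), S.γ'_mul_self, one_mul, S.γ_mul_self]

theorem parity_mul_self (S : FermionSystem V) :
    S.parity * S.parity = (-1 : ℂ) ^ S.n • (1 : S.Op) := by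
  refine List.prod_ofFn_mul_self _ (fun k l => ?_) S.γ_mul_γ'_mul_self
  rcases eq_or_ne k l with rfl | h
  · rfl
  · rw [← mul_assoc, pair_mul_of_anticomm (S.γ_anticomm h)
      (by rw [S.γ_anticomm_γ' l k, neg_neg]), mul_assoc,
      pair_mul_of_anticomm (S.γ_anticomm_γ' k l) (S.γ'_anticomm h), ← mul_assoc]

/-- The grading automorphism: conjugation by the fermion parity. -/
noncomputable def grading (S : FermionSystem V) : S.Op ≃⋆ₐ[ℂ] S.Op :=
  Unitary.conjStarAlgAut ℂ S.Op ⟨S.parity, S.parity_mem_unitary⟩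

theorem grading_apply (S : FermionSystem V) (O : S.Op) :
    S.grading O = S.parity * O * star S.parity := rfl

theorem grading_eq_of_mul_eq (S : FermionSystem V) {O O' : S.Op}
    (h : S.parity * O = O' * S.parity) : S.grading O = O' := by
  rw [grading_apply, h, mul_assoc, Unitary.mul_star_self_of_mem S.parity_mem_unitary, mul_one]

theorem mul_eq_of_grading_eq (S : FermionSystem V) {O O' : S.Op} (h : S.grading O = O') :
    S.parity * O = O' * S.parity := by
  rw [← h, grading_apply, mul_assoc, Unitary.star_mul_self_of_mem S.parity_mem_unitary, mul_one]

theorem isEven_iff (S : FermionSystem V) (O : S.Op) : S.IsEven O ↔ S.grading O = O :=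
  ⟨S.grading_eq_of_mul_eq, S.mul_eq_of_grading_eq⟩

theorem isOdd_iff (S : FermionSystem V) (O : S.Op) : S.IsOdd O ↔ S.grading O = -O :=
  ⟨fun h => S.grading_eq_of_mul_eq (by rw [neg_mul]; exact h),
    fun h => by rw [IsOdd, ← neg_mul]; exact S.mul_eq_of_grading_eq h⟩

/-- The parity operator squares to the scalar `(-1) ^ n` and is Hermitian or anti-Hermitian
accordingly, so this phase occurs twice and cancels. -/
theorem grading_grading (S : FermionSystem V) (O : S.Op) : S.grading (S.grading O) = O := by
  refine S.grading_eq_of_mul_eq ?_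
  have h := S.parity_mul_self
  have h1 : star S.parity = (-1 : ℂ) ^ S.n • S.parity := by
    have h2 : star S.parity * (S.parity * S.parity) = S.parity := by
      rw [← mul_assoc, Unitary.star_mul_self_of_mem S.parity_mem_unitary, one_mul]
    rw [h, mul_smul_comm, mul_one] at h2
    nth_rw 2 [← h2]
    rw [smul_smul, ← mul_pow]; simp
  rw [grading_apply, h1, mul_smul_comm, mul_smul_comm, ← mul_assoc, ← mul_assoc, h,
    smul_mul_assoc, one_mul, smul_mul_assoc, smul_smul, ← mul_pow]
  simp

theorem trace_grading (S : FermionSystem V) (O : S.Op) : (S.grading O).trace = O.trace := by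
  rw [grading_apply, Matrix.trace_mul_comm, ← mul_assoc,
    Unitary.star_mul_self_of_mem S.parity_mem_unitary, one_mul]

theorem grading_γ (S : FermionSystem V) (k : Fin S.n) : S.grading (S.γ k) = -S.γ k :=
  (S.isOdd_iff _).1 (S.parity_mul_γ k)

theorem grading_γ' (S : FermionSystem V) (k : Fin S.n) : S.grading (S.γ' k) = -S.γ' k :=
  (S.isOdd_iff _).1 (S.parity_mul_γ' k)

theorem grading_quditOp (S : FermionSystem V) (v : V)
    (B : Matrix (Fin (S.d v)) (Fin (S.d v)) ℂ) :
    S.grading (S.quditOp v B) = S.quditOp v B :=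
  (S.isEven_iff _).1 (S.parity_mul_quditOp v B)

/-- Labels of the generators: the two families of Majorana operators, and the qudits. -/
abbrev Label (S : FermionSystem V) : Type _ := Fin S.n ⊕ Fin S.n ⊕ V

/-- The operators with a given label. -/
def gen (S : FermionSystem V) : S.Label → Set S.Op
  | .inl k => {S.γ k}
  | .inr (.inl k) => {S.γ' k}
  | .inr (.inr v) => Set.range (S.quditOp v)

/-- The site of a generator. -/
def site (S : FermionSystem V) : S.Label → V
  | .inl k => S.siteγ k
  | .inr (.inl k) => S.siteγ' k
  | .inr (.inr v) => v

/-- The algebra generated by the operators with labels in `F`. -/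
def labelAlgebra (S : FermionSystem V) (F : Set S.Label) : Subalgebra ℂ S.Op :=
  Algebra.adjoin ℂ (⋃ l ∈ F, S.gen l)

theorem localAlgebra_eq (S : FermionSystem V) (T : Set V) :
    S.localAlgebra T = S.labelAlgebra {l | S.site l ∈ T} := by
  unfold localAlgebra labelAlgebra
  congr 1
  ext O
  simp only [Set.mem_union, Set.mem_ofPred_eq, Set.mem_iUnion]
  constructor
  · rintro ((⟨k, hk, rfl⟩ | ⟨k, hk, rfl⟩) | ⟨v, hv, B, rfl⟩)
    · exact ⟨.inl k, hk, rfl⟩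
    · exact ⟨.inr (.inl k), hk, rfl⟩
    · exact ⟨.inr (.inr v), hv, B, rfl⟩
  · rintro ⟨k | k | v, hk, h⟩
    · exact .inl (.inl ⟨k, hk, h⟩)
    · exact .inl (.inr ⟨k, hk, h⟩)
    · obtain ⟨B, rfl⟩ := h
      exact .inr ⟨v, hk, B, rfl⟩

theorem gen_homogeneous (S : FermionSystem V) (l : S.Label) {O : S.Op} (h : O ∈ S.gen l) :
    S.grading O = O ∨ S.grading O = -O := by
  rcases l with k | k | v
  · obtain rfl : O = S.γ k := h
    exact .inr (S.grading_γ k)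
  · obtain rfl : O = S.γ' k := h
    exact .inr (S.grading_γ' k)
  · obtain ⟨B, rfl⟩ := h
    exact .inl (S.grading_quditOp v B)

theorem star_mem_gen (S : FermionSystem V) (l : S.Label) {O : S.Op} (h : O ∈ S.gen l) :
    star O ∈ S.gen l := by
  rcases l with k | k | v
  · obtain rfl : O = S.γ k := h
    exact S.star_γ k
  · obtain rfl : O = S.γ' k := h
    exact S.star_γ' k
  · obtain ⟨B, rfl⟩ := h
    exact ⟨star B, (S.star_quditOp v B).symm⟩

theorem gen_superCommute (S : FermionSystem V) {l l' : S.Label} (h : l ≠ l') :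
    SuperCommute S.grading (S.gen l) (S.gen l') := by
  rcases l with k | k | v <;> rcases l' with k' | k' | v' <;> intro x hx y hy
  · obtain rfl : x = S.γ k := hx
    obtain rfl : y = S.γ k' := hy
    exact superCommute_pair_of_odd (S.grading_γ _) (S.grading_γ _)
      (S.γ_anticomm (by rintro rfl; exact h rfl))
  · obtain rfl : x = S.γ k := hx
    obtain rfl : y = S.γ' k' := hy
    exact superCommute_pair_of_odd (S.grading_γ _) (S.grading_γ' _) (S.γ_anticomm_γ' _ _)
  · obtain rfl : x = S.γ k := hx
    obtain ⟨B, rfl⟩ := hy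
    exact superCommute_pair_of_right_even (S.grading_quditOp _ _) (S.quditOp_comm_γ _ _ _).symm
  · obtain rfl : x = S.γ' k := hx
    obtain rfl : y = S.γ k' := hy
    exact superCommute_pair_of_odd (S.grading_γ' _) (S.grading_γ _)
      (by rw [S.γ_anticomm_γ', neg_neg])
  · obtain rfl : x = S.γ' k := hx
    obtain rfl : y = S.γ' k' := hy
    exact superCommute_pair_of_odd (S.grading_γ' _) (S.grading_γ' _)
      (S.γ'_anticomm (by rintro rfl; exact h rfl))
  · obtain rfl : x = S.γ' k := hx
    obtain ⟨B, rfl⟩ := hy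
    exact superCommute_pair_of_right_even (S.grading_quditOp _ _) (S.quditOp_comm_γ' _ _ _).symm
  · obtain rfl : y = S.γ k' := hy
    obtain ⟨B, rfl⟩ := hx
    exact superCommute_pair_of_left_even (S.grading_quditOp _ _) (S.quditOp_comm_γ _ _ _)
  · obtain rfl : y = S.γ' k' := hy
    obtain ⟨B, rfl⟩ := hx
    exact superCommute_pair_of_left_even (S.grading_quditOp _ _) (S.quditOp_comm_γ' _ _ _)
  · obtain ⟨B, rfl⟩ := hx
    obtain ⟨C, rfl⟩ := hy
    exact superCommute_pair_of_left_even (S.grading_quditOp _ _)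
      (S.quditOp_comm (by rintro rfl; exact h rfl) _ _)

theorem labelAlgebra_homogeneous (S : FermionSystem V) (F : Set S.Label) :
    ∀ x ∈ ⋃ l ∈ F, S.gen l, S.grading x = x ∨ S.grading x = -x := by
  intro x hx
  simp only [Set.mem_iUnion] at hx
  obtain ⟨l, _, hl⟩ := hx
  exact S.gen_homogeneous l hl

theorem labelAlgebra_stable (S : FermionSystem V) (F : Set S.Label) :
    ∀ x ∈ S.labelAlgebra F, S.grading x ∈ S.labelAlgebra F :=
  adjoin_stable (S.labelAlgebra_homogeneous F)

theorem star_mem_labelAlgebra (S : FermionSystem V) (F : Set S.Label) :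
    ∀ x ∈ S.labelAlgebra F, star x ∈ S.labelAlgebra F := by
  refine adjoin_star_mem fun x hx => ?_
  simp only [Set.mem_iUnion] at hx ⊢
  obtain ⟨l, hF, hl⟩ := hx
  exact ⟨l, hF, S.star_mem_gen l hl⟩

theorem labelAlgebra_superCommute (S : FermionSystem V) {F F' : Set S.Label}
    (h : Disjoint F F') :
    SuperCommute S.grading (S.labelAlgebra F : Set S.Op) (S.labelAlgebra F') := by
  refine SuperCommute.adjoin S.grading_grading ?_ (S.labelAlgebra_homogeneous F)
    (S.labelAlgebra_homogeneous F')
  intro x hx y hy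
  simp only [Set.mem_iUnion] at hx hy
  obtain ⟨l, hF, hl⟩ := hx
  obtain ⟨l', hF', hl'⟩ := hy
  exact S.gen_superCommute (h.ne_of_mem hF hF') x hl y hl'

theorem labelAlgebra_mono (S : FermionSystem V) {F F' : Set S.Label} (h : F ⊆ F') :
    S.labelAlgebra F ≤ S.labelAlgebra F' :=
  Algebra.adjoin_mono (Set.biUnion_subset_biUnion_left h)

theorem labelAlgebra_union_le (S : FermionSystem V) {F F' : Set S.Label} (h : Disjoint F F') :
    Subalgebra.toSubmodule (S.labelAlgebra (F ∪ F')) ≤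
      Subalgebra.toSubmodule (S.labelAlgebra F) * Subalgebra.toSubmodule (S.labelAlgebra F') := by
  refine le_trans ?_ (SuperCommute.sup_le_mul S.grading_grading (S.labelAlgebra_superCommute h)
    (S.labelAlgebra_stable F) (S.labelAlgebra_stable F'))
  rw [labelAlgebra, Set.biUnion_union, Algebra.adjoin_union]
  exact le_rfl

/-- By cyclicity and supercommutation the trace of `y * g` is that of `grading y * g`. Applying the
grading, which preserves the trace, gives its negative. No parity of `y` is needed. -/
theorem trace_mul_of_odd_gen (S : FermionSystem V) {F : Set S.Label} {l : S.Label} (hl : l ∉ F)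
    {g : S.Op} (hg : g ∈ S.gen l) (hodd : S.grading g = -g) {y : S.Op}
    (hy : y ∈ S.labelAlgebra F) : (y * g).trace = 0 := by
  have hgl : g ∈ S.labelAlgebra {l} := Algebra.subset_adjoin (by simpa using hg)
  have h := (S.labelAlgebra_superCommute (Set.disjoint_singleton_left.2 hl) g hgl y hy).2 hodd
  have h1 : (y * g).trace = -(y * g).trace := by
    conv_lhs => rw [Matrix.trace_mul_comm, h, ← S.trace_grading, map_mul, S.grading_grading, hodd,
      mul_neg, Matrix.trace_neg]
  exact self_eq_neg.1 h1

theorem card_config_ne_zero (S : FermionSystem V) : (Fintype.card S.Config : ℂ) ≠ 0 := by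
  have : Nonempty S.Config := ⟨(fun v => ⟨0, S.d_pos v⟩, fun _ => false)⟩
  exact_mod_cast Fintype.card_ne_zero

/-- A Majorana operator `g` generates only the span of `1` and `g`, and the traces containing `g`
vanish. For a qudit, which commutes with `y`, the map `B ↦ tr (y B)` is tracial on a full matrix
algebra and hence proportional to the trace. -/
theorem trace_mul_gen (S : FermionSystem V) {F : Set S.Label} {l : S.Label} (hl : l ∉ F)
    {y q : S.Op} (hy : y ∈ S.labelAlgebra F) (hq : q ∈ S.labelAlgebra {l}) :
    (Fintype.card S.Config : ℂ) * (y * q).trace = y.trace * q.trace := by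
  have hmaj : ∀ g, S.gen l = {g} → S.grading g = -g → g * g = 1 →
      (Fintype.card S.Config : ℂ) * (y * q).trace = y.trace * q.trace := by
    intro g hgl hodd hsq
    have hg : g ∈ S.gen l := by rw [hgl]; rfl
    have hform : ∃ c d : ℂ, q = c • 1 + d • g := by
      have hq' : q ∈ Algebra.adjoin ℂ {g} := by simpa [labelAlgebra, hgl] using hq
      induction hq' using Algebra.adjoin_induction with
      | mem x hx => exact ⟨0, 1, by simpa using hx⟩
      | algebraMap c => exact ⟨c, 0, by simp [Algebra.algebraMap_eq_smul_one]⟩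
      | add x y hx' hy' hx hy =>
        obtain ⟨c, d, rfl⟩ := hx (by simpa [labelAlgebra, hgl] using hx')
        obtain ⟨c', d', rfl⟩ := hy (by simpa [labelAlgebra, hgl] using hy')
        exact ⟨c + c', d + d', by module⟩
      | mul x y hx' hy' hx hy =>
        obtain ⟨c, d, rfl⟩ := hx (by simpa [labelAlgebra, hgl] using hx')
        obtain ⟨c', d', rfl⟩ := hy (by simpa [labelAlgebra, hgl] using hy')
        refine ⟨c * c' + d * d', c * d' + d * c', ?_⟩
        simp only [mul_add, add_mul, smul_mul_smul_comm, one_mul, mul_one, hsq]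
        module
    obtain ⟨c, d, rfl⟩ := hform
    have h1 := S.trace_mul_of_odd_gen hl hg hodd hy
    have h2 := S.trace_mul_of_odd_gen hl hg hodd (one_mem _)
    rw [one_mul] at h2
    simp only [mul_add, mul_smul_comm, mul_one, Matrix.trace_add, Matrix.trace_smul, h1, h2,
      Matrix.trace_one, smul_eq_mul, mul_zero, add_zero]
    ring
  rcases l with k | k | v
  · exact hmaj _ rfl (S.grading_γ k) (S.γ_mul_self k)
  · exact hmaj _ rfl (S.grading_γ' k) (S.γ'_mul_self k)
  · have hq' : ∃ B, q = S.quditOp v B := by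
      have : S.labelAlgebra {Sum.inr (Sum.inr v)} ≤ (S.quditHom v).range := by
        refine Algebra.adjoin_le fun x hx => ?_
        simpa [gen, quditHom_apply] using hx
      obtain ⟨B, hB⟩ := this hq
      exact ⟨B, hB.symm⟩
    obtain ⟨B, rfl⟩ := hq'
    have key : ∀ z ∈ S.labelAlgebra F,
        (S.d v : ℂ) * (z * S.quditOp v B).trace = B.trace * z.trace := by
      intro z hz
      have hc : ∀ C, S.quditOp v C * z = z * S.quditOp v C := fun C =>
        (S.labelAlgebra_superCommute (Set.disjoint_singleton_left.2 hl) _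
          (Algebra.subset_adjoin (by simp [gen])) z hz).1 (S.grading_quditOp v C)
      have := Matrix.card_smul_tracial
        ((Matrix.traceLinearMap S.Config ℂ ℂ) ∘ₗ (LinearMap.mulLeft ℂ z) ∘ₗ
          (S.quditHom v).toLinearMap) (fun C D => by
            simp only [LinearMap.comp_apply, AlgHom.toLinearMap_apply, map_mul,
              LinearMap.mulLeft_apply, Matrix.traceLinearMap_apply, quditHom_apply]
            rw [← mul_assoc, Matrix.trace_mul_comm, ← mul_assoc, hc, mul_assoc]) B
      simpa [quditHom_apply, quditOp_one] using this
    have h1 := key y hy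
    have h2 := key 1 (one_mem _)
    rw [one_mul, Matrix.trace_one] at h2
    have hd : (S.d v : ℂ) ≠ 0 := by exact_mod_cast (S.d_pos v).ne'
    apply mul_left_cancel₀ hd
    linear_combination (Fintype.card S.Config : ℂ) * h1 - y.trace * h2

/-- The normalized trace is a product state. One label of `F'` is split off at a time: `b = b0 * q`,
where `q` separates from both `a * b0` and `b0`. -/
theorem trace_mul_labelAlgebra (S : FermionSystem V) {F F' : Set S.Label} (h : Disjoint F F')
    {a b : S.Op} (ha : a ∈ S.labelAlgebra F) (hb : b ∈ S.labelAlgebra F') :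
    (Fintype.card S.Config : ℂ) * (a * b).trace = a.trace * b.trace := by
  induction F', Set.toFinite F' using Set.Finite.induction_on generalizing b with
  | empty =>
    have hb' : b ∈ (⊥ : Subalgebra ℂ S.Op) := by simpa [labelAlgebra] using hb
    obtain ⟨c, rfl⟩ := Algebra.mem_bot.1 hb'
    simp only [Algebra.algebraMap_eq_smul_one, mul_smul_comm, mul_one, Matrix.trace_smul,
      Matrix.trace_one, smul_eq_mul]
    ring
  | @insert l F' hl _ ih =>
    have hd : Disjoint F F' := h.mono_right (Set.subset_insert _ _)
    have hlF : l ∉ F := fun h' => (Set.disjoint_left.1 h) h' (Set.mem_insert _ _)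
    have hb' : b ∈ Subalgebra.toSubmodule (S.labelAlgebra F') *
        Subalgebra.toSubmodule (S.labelAlgebra {l}) := by
      refine S.labelAlgebra_union_le (Set.disjoint_singleton_right.2 hl) ?_
      rw [Set.union_singleton]
      exact hb
    induction hb' using Submodule.mul_induction_on' with
    | mem_mul_mem b0 hb0 q hq =>
      have hab : a * b0 ∈ S.labelAlgebra (F ∪ F') :=
        mul_mem (S.labelAlgebra_mono Set.subset_union_left ha)
          (S.labelAlgebra_mono Set.subset_union_right hb0)
      have h1 := S.trace_mul_gen (l := l) (by simp [hl, hlF]) hab hq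
      have h2 := S.trace_mul_gen hl hb0 hq
      have h3 := ih hd hb0
      rw [mul_assoc] at h1
      apply mul_left_cancel₀ S.card_config_ne_zero
      linear_combination (Fintype.card S.Config : ℂ) * h1 + q.trace * h3 - a.trace * h2
    | add x hx y hy hx' hy' =>
      have hle : Subalgebra.toSubmodule (S.labelAlgebra F') *
          Subalgebra.toSubmodule (S.labelAlgebra {l}) ≤
          Subalgebra.toSubmodule (S.labelAlgebra (insert l F')) := by
        rw [Submodule.mul_le]
        exact fun u hu w hw => mul_mem (S := Subalgebra ℂ S.Op)
          (S.labelAlgebra_mono (Set.subset_insert _ _) hu)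
          (S.labelAlgebra_mono (Set.singleton_subset_iff.2 (Set.mem_insert _ _)) hw)
      rw [mul_add, Matrix.trace_add, Matrix.trace_add, mul_add, mul_add, hx' (hle hx),
        hy' (hle hy)]

-- Disjoint regions behave like tensor factors. For `x` in the first algebra put `z = ∑ tr (x a_i)
-- b_i`; factorization of the trace makes `tr (z z*)` a multiple of `tr (x (∑ a_i b_i) z*) = 0`. So
-- `z = 0`, independence gives `tr (x a_i) = 0`, and `x = star (a i)` finishes.
open scoped ComplexOrder in
theorem eq_zero_of_sum_mul_eq_zero (S : FermionSystem V) {F F' : Set S.Label}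
    (h : Disjoint F F') {ι : Type*} [Fintype ι] {a b : ι → S.Op}
    (ha : ∀ i, a i ∈ S.labelAlgebra F) (hb : ∀ i, b i ∈ S.labelAlgebra F')
    (hlin : LinearIndependent ℂ b) (hsum : ∑ i, a i * b i = 0) (i : ι) : a i = 0 := by
  have htr : ∀ x ∈ S.labelAlgebra F, ∀ i, (x * a i).trace = 0 := by
    intro x hx
    refine Fintype.linearIndependent_iff.1 hlin _ ?_
    set z := ∑ i, (x * a i).trace • b i
    have hz : z ∈ S.labelAlgebra F' := sum_mem fun i _ => Subalgebra.smul_mem _ (hb i) _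
    have hzs := S.star_mem_labelAlgebra _ _ hz
    have h0 : (z * zᴴ).trace = 0 := by
      have h1 : (x * (∑ i, a i * b i) * star z).trace = 0 := by simp [hsum]
      rw [Finset.mul_sum, Finset.sum_mul, Matrix.trace_sum] at h1
      have h2 : ∀ i, (Fintype.card S.Config : ℂ) * (x * (a i * b i) * star z).trace =
          (x * a i).trace * (b i * star z).trace := by
        intro i
        rw [← mul_assoc x, mul_assoc _ (b i)]
        exact S.trace_mul_labelAlgebra h (mul_mem hx (ha i)) (mul_mem (hb i) hzs)
      have h3 : z * zᴴ = ∑ i, (x * a i).trace • (b i * star z) := by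
        rw [← Matrix.star_eq_conjTranspose]
        conv_lhs => enter [1]; simp only [z]
        rw [Finset.sum_mul]
        simp only [smul_mul_assoc]
      rw [h3, Matrix.trace_sum]
      simp only [Matrix.trace_smul, smul_eq_mul, ← h2]
      rw [← Finset.mul_sum, h1, mul_zero]
    exact Matrix.trace_mul_conjTranspose_self_eq_zero_iff.1 h0
  refine Matrix.trace_conjTranspose_mul_self_eq_zero_iff.1 ?_
  exact htr _ (S.star_mem_labelAlgebra _ _ (ha i)) i

end FermionSystem

/-! ### Minimal homogeneous decompositions of products. -/

/-- An element of a product of two submodules has a decomposition of minimal length. -/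
theorem Submodule.exists_linearIndependent_of_mem_mul {A : Type*} [Ring A] [Algebra ℂ A]
    {M N : Submodule ℂ A} {p : A} (hp : p ∈ M * N) :
    ∃ (r : ℕ) (a b : Fin r → A), (∀ i, a i ∈ M) ∧ (∀ i, b i ∈ N) ∧ p = ∑ i, a i * b i ∧
      LinearIndependent ℂ a ∧ LinearIndependent ℂ b := by
  classical
  have hex : ∃ r, ∃ a b : Fin r → A, (∀ i, a i ∈ M) ∧ (∀ i, b i ∈ N) ∧ p = ∑ i, a i * b i := by
    induction hp using Submodule.mul_induction_on' with
    | mem_mul_mem m hm n hn => exact ⟨1, fun _ => m, fun _ => n, fun _ => hm, fun _ => hn, by simp⟩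
    | add x hx y hy hx' hy' =>
      obtain ⟨r, a, b, ha, hb, rfl⟩ := hx'
      obtain ⟨s, a', b', ha', hb', rfl⟩ := hy'
      refine ⟨r + s, Fin.append a a', Fin.append b b', ?_, ?_, ?_⟩
      · intro i; refine Fin.addCases (fun i => ?_) (fun i => ?_) i <;> simp [ha, ha']
      · intro i; refine Fin.addCases (fun i => ?_) (fun i => ?_) i <;> simp [hb, hb']
      · simp [Fin.sum_univ_add]
  have hmin := fun m (hm : m < Nat.find hex) => Nat.find_min hex hm
  obtain ⟨a, b, ha, hb, hab⟩ := Nat.find_spec hex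
  generalize Nat.find hex = r at hmin a b ha hb hab
  refine ⟨r, a, b, ha, hb, hab, ?_, ?_⟩
  · by_contra hdep
    obtain ⟨g, hg, j, hj⟩ := Fintype.not_linearIndependent_iff.1 hdep
    obtain ⟨r, rfl⟩ : ∃ r', r = r' + 1 := ⟨r - 1, by have := j.2; omega⟩
    -- Solving the relation for `a j` and absorbing its term into the other second factors shortens
    -- the decomposition.
    refine hmin r (Nat.lt_succ_self r) ⟨fun i => a (j.succAbove i),
      fun i => b (j.succAbove i) - ((g j)⁻¹ * g (j.succAbove i)) • b j, fun i => ha _,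
      fun i => N.sub_mem (hb _) (N.smul_mem _ (hb _)), ?_⟩
    rw [Fin.sum_univ_succAbove _ j] at hg hab
    have haj : a j = -∑ i, ((g j)⁻¹ * g (j.succAbove i)) • a (j.succAbove i) := by
      have := congrArg (fun z => (g j)⁻¹ • z) hg
      simp only [smul_add, smul_smul, inv_mul_cancel₀ hj, one_smul, smul_zero,
        Finset.smul_sum] at this
      exact eq_neg_of_add_eq_zero_left this
    rw [hab, haj]
    simp only [mul_sub, Finset.sum_sub_distrib, neg_mul, Finset.sum_mul, smul_mul_assoc,
      mul_smul_comm]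
    abel
  · by_contra hdep
    obtain ⟨g, hg, j, hj⟩ := Fintype.not_linearIndependent_iff.1 hdep
    obtain ⟨r, rfl⟩ : ∃ r', r = r' + 1 := ⟨r - 1, by have := j.2; omega⟩
    refine hmin r (Nat.lt_succ_self r) ⟨
      fun i => a (j.succAbove i) - ((g j)⁻¹ * g (j.succAbove i)) • a j,
      fun i => b (j.succAbove i),
      fun i => M.sub_mem (ha _) (M.smul_mem _ (ha _)), fun i => hb _, ?_⟩
    rw [Fin.sum_univ_succAbove _ j] at hg hab
    have hbj : b j = -∑ i, ((g j)⁻¹ * g (j.succAbove i)) • b (j.succAbove i) := by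
      have := congrArg (fun z => (g j)⁻¹ • z) hg
      simp only [smul_add, smul_smul, inv_mul_cancel₀ hj, one_smul, smul_zero,
        Finset.smul_sum] at this
      exact eq_neg_of_add_eq_zero_left this
    rw [hab, hbj]
    simp only [sub_mul, Finset.sum_sub_distrib, mul_neg, Finset.mul_sum, smul_mul_assoc,
      mul_smul_comm]
    abel

section Graded

variable {A : Type*} [Ring A] [Algebra ℂ A] [StarRing A] [StarModule ℂ A]

/-- The even elements. -/
def evenSubmodule (α : A ≃⋆ₐ[ℂ] A) : Submodule ℂ A where
  carrier := {x | α x = x}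
  add_mem' := fun {x y} hx hy => by
    simp only [Set.mem_ofPred_eq] at hx hy ⊢; rw [map_add, hx, hy]
  zero_mem' := map_zero α
  smul_mem' := fun c x hx => by
    simp only [Set.mem_ofPred_eq] at hx ⊢; rw [map_smul, hx]

/-- The odd elements. -/
def oddSubmodule (α : A ≃⋆ₐ[ℂ] A) : Submodule ℂ A where
  carrier := {x | α x = -x}
  add_mem' := fun {x y} hx hy => by
    simp only [Set.mem_ofPred_eq] at hx hy ⊢; rw [map_add, hx, hy, neg_add]
  zero_mem' := by simp
  smul_mem' := fun c x hx => by
    simp only [Set.mem_ofPred_eq] at hx ⊢; rw [map_smul, hx, smul_neg]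

variable {α : A ≃⋆ₐ[ℂ] A}

theorem mem_oddSubmodule {x : A} : x ∈ oddSubmodule α ↔ α x = -x := Iff.rfl

theorem disjoint_evenSubmodule_oddSubmodule : Disjoint (evenSubmodule α) (oddSubmodule α) :=
  Submodule.disjoint_def.2 fun _ h0 h1 => eq_zero_of_even_of_odd h0 h1

theorem evenPart_add (x y : A) : evenPart α (x + y) = evenPart α x + evenPart α y := by
  simp only [evenPart, map_add, ← smul_add]; congr 1; abel

theorem evenPart_mul (x y : A) :
    evenPart α (x * y) = evenPart α x * evenPart α y + oddPart α x * oddPart α y := by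
  simp only [evenPart, oddPart, map_mul, smul_mul_smul_comm, ← smul_add, mul_add, add_mul, mul_sub,
    sub_mul]
  module

theorem evenPart_mem_mul {M N : Submodule ℂ A} (hα : ∀ x, α (α x) = x) (hM : ∀ x ∈ M, α x ∈ M)
    (hN : ∀ x ∈ N, α x ∈ N) {x : A} (hx : x ∈ M * N) :
    evenPart α x ∈ (M ⊓ evenSubmodule α) * (N ⊓ evenSubmodule α) ⊔
      (M ⊓ oddSubmodule α) * (N ⊓ oddSubmodule α) := by
  induction hx using Submodule.mul_induction_on' with
  | mem_mul_mem m hm n hn =>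
    rw [evenPart_mul]
    exact Submodule.add_mem_sup
      (Submodule.mul_mem_mul ⟨evenPart_mem hM hm, map_evenPart hα m⟩
        ⟨evenPart_mem hN hn, map_evenPart hα n⟩)
      (Submodule.mul_mem_mul ⟨oddPart_mem hM hm, map_oddPart hα m⟩
        ⟨oddPart_mem hN hn, map_oddPart hα n⟩)
  | add x hx y hy hx' hy' =>
    rw [evenPart_add]
    exact add_mem hx' hy'

/-- Even elements of a product of graded submodules have a decomposition of minimal length into
products of homogeneous elements of equal parity. -/
theorem exists_homogeneous_decomposition {M N : Submodule ℂ A} (hα : ∀ x, α (α x) = x)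
    (hM : ∀ x ∈ M, α x ∈ M) (hN : ∀ x ∈ N, α x ∈ N) {p : A} (hp : p ∈ M * N) (heven : α p = p) :
    ∃ (r s : ℕ) (a b : Fin r ⊕ Fin s → A), (∀ i, a i ∈ M) ∧ (∀ i, b i ∈ N) ∧
      (∀ i, (α (a i) = a i ∧ α (b i) = b i) ∨ (α (a i) = -a i ∧ α (b i) = -b i)) ∧
      p = ∑ i, a i * b i ∧ LinearIndependent ℂ a ∧ LinearIndependent ℂ b := by
  have h := evenPart_mem_mul hα hM hN hp
  rw [evenPart_of_even heven] at h
  obtain ⟨p0, h0, p1, h1, rfl⟩ := Submodule.mem_sup.1 h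
  obtain ⟨r, a, b, ha, hb, rfl, hla, hlb⟩ := Submodule.exists_linearIndependent_of_mem_mul h0
  obtain ⟨s, a', b', ha', hb', rfl, hla', hlb'⟩ := Submodule.exists_linearIndependent_of_mem_mul h1
  have hdisj : ∀ (u : Fin r → A) (u' : Fin s → A), (∀ i, α (u i) = u i) →
      (∀ i, α (u' i) = -u' i) →
      Disjoint (Submodule.span ℂ (Set.range u)) (Submodule.span ℂ (Set.range u')) := by
    intro u u' hu hu'
    refine (disjoint_evenSubmodule_oddSubmodule (α := α)).mono ?_ ?_ <;> rw [Submodule.span_le]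
    · rintro _ ⟨i, rfl⟩; exact hu i
    · rintro _ ⟨i, rfl⟩; exact hu' i
  refine ⟨r, s, Sum.elim a a', Sum.elim b b', ?_, ?_, ?_, ?_, ?_, ?_⟩
  · rintro (i | i)
    · exact (ha i).1
    · exact (ha' i).1
  · rintro (i | i)
    · exact (hb i).1
    · exact (hb' i).1
  · rintro (i | i)
    · exact .inl ⟨(ha i).2, (hb i).2⟩
    · exact .inr ⟨(ha' i).2, (hb' i).2⟩
  · simp
  · exact hla.sum_type hla' (hdisj _ _ (fun i => (ha i).2) (fun i => (ha' i).2))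
  · exact hlb.sum_type hlb' (hdisj _ _ (fun i => (hb i).2) (fun i => (hb' i).2))

end Graded

/-! ### Supercommuting site algebras of commuting edge operators. -/

namespace FermionSystem

variable {V : Type*} [Fintype V] [DecidableEq V]

theorem disjoint_sites (S : FermionSystem V) {T T' : Set V} (h : Disjoint T T') :
    Disjoint {l | S.site l ∈ T} {l | S.site l ∈ T'} :=
  Set.disjoint_left.2 fun _ hl hl' => Set.disjoint_left.1 h hl hl'

theorem localAlgebra_superCommute (S : FermionSystem V) {T T' : Set V} (h : Disjoint T T') :
    SuperCommute S.grading (S.localAlgebra T : Set S.Op) (S.localAlgebra T') := by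
  rw [localAlgebra_eq, localAlgebra_eq]
  exact S.labelAlgebra_superCommute (S.disjoint_sites h)

theorem localAlgebra_stable (S : FermionSystem V) (T : Set V) :
    ∀ x ∈ S.localAlgebra T, S.grading x ∈ S.localAlgebra T := by
  rw [localAlgebra_eq]; exact S.labelAlgebra_stable _

theorem star_mem_localAlgebra (S : FermionSystem V) (T : Set V) :
    ∀ x ∈ S.localAlgebra T, star x ∈ S.localAlgebra T := by
  rw [localAlgebra_eq]; exact S.star_mem_labelAlgebra _

theorem localAlgebra_mono (S : FermionSystem V) {T T' : Set V} (h : T ⊆ T') :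
    S.localAlgebra T ≤ S.localAlgebra T' := by
  rw [localAlgebra_eq, localAlgebra_eq]
  exact S.labelAlgebra_mono fun _ hl => h hl

theorem localAlgebra_union_le (S : FermionSystem V) {T T' : Set V} (h : Disjoint T T') :
    Subalgebra.toSubmodule (S.localAlgebra (T ∪ T')) ≤
      Subalgebra.toSubmodule (S.localAlgebra T) * Subalgebra.toSubmodule (S.localAlgebra T') := by
  rw [localAlgebra_eq, localAlgebra_eq, localAlgebra_eq]
  exact S.labelAlgebra_union_le (S.disjoint_sites h)

theorem eq_zero_of_sum_mul_eq_zero' (S : FermionSystem V) {T T' : Set V}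
    (h : Disjoint T T') {ι : Type*} [Fintype ι] {a b : ι → S.Op}
    (ha : ∀ i, a i ∈ S.localAlgebra T) (hb : ∀ i, b i ∈ S.localAlgebra T')
    (hlin : LinearIndependent ℂ b) (hsum : ∑ i, a i * b i = 0) (i : ι) : a i = 0 := by
  simp only [localAlgebra_eq] at ha hb
  exact S.eq_zero_of_sum_mul_eq_zero (S.disjoint_sites h) ha hb hlin hsum i

/-- A decomposition of an even operator on two sites `v` and `w` into products of homogeneous
operators, with linearly independent second factors. -/
structure IsDecomposition (S : FermionSystem V) (P : S.Op) (v w : V) {ι : Type*} [Fintype ι]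
    (x y : ι → S.Op) : Prop where
  left_mem : ∀ i, x i ∈ S.localAlgebra {v}
  right_mem : ∀ i, y i ∈ S.localAlgebra {w}
  parity_eq : ∀ i, (S.grading (x i) = x i ∧ S.grading (y i) = y i) ∨
    (S.grading (x i) = -x i ∧ S.grading (y i) = -y i)
  sum_eq : P = ∑ i, x i * y i
  linearIndependent : LinearIndependent ℂ y

/-- Exchanging the factors costs a sign exactly for odd pairs, and the grading of the left factor
supplies it. -/
theorem IsDecomposition.swap {S : FermionSystem V} {P : S.Op} {v w : V} (hvw : v ≠ w)
    {ι : Type*} [Fintype ι] {x y : ι → S.Op} (h : S.IsDecomposition P v w x y)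
    (hx : LinearIndependent ℂ x) : S.IsDecomposition P w v y (fun i => S.grading (x i)) where
  left_mem := h.right_mem
  right_mem := fun i => S.localAlgebra_stable _ _ (h.left_mem i)
  parity_eq := fun i => by
    rcases h.parity_eq i with ⟨h0, h1⟩ | ⟨h0, h1⟩ <;> simp [h0, h1]
  sum_eq := by
    rw [h.sum_eq]
    refine Finset.sum_congr rfl fun i _ => ?_
    have hp := S.localAlgebra_superCommute (Set.disjoint_singleton.2 hvw.symm) _ (h.right_mem i) _
      (h.left_mem i)
    rcases h.parity_eq i with ⟨h0, h1⟩ | ⟨h0, h1⟩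
    · rw [h0, hp.1 h1]
    · rw [h0, mul_neg, hp.2 h1, h0, neg_mul, neg_neg]
  linearIndependent := hx.map' (S.grading.toAlgEquiv.toLinearEquiv : S.Op →ₗ[ℂ] S.Op)
    (LinearEquiv.ker _)

/-- `P` is even and lives away from `w`, so it passes each `y i` and the commutator with `R` becomes
`∑ [P, x i] * y i`. Independence of the `y i` then applies; this needs the far ends `u` and `w` to
differ. -/
theorem IsDecomposition.commute_left {S : FermionSystem V} {P R : S.Op} {u v w : V}
    (huw : u ≠ w) (hvw : v ≠ w) {ι : Type*} [Fintype ι] {x y : ι → S.Op}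
    (h : S.IsDecomposition R v w x y) (hP : P ∈ S.localAlgebra {v, u}) (heven : S.grading P = P)
    (hcomm : P * R = R * P) (i : ι) : P * x i = x i * P := by
  have hd : Disjoint ({v, u} : Set V) {w} := by
    rw [Set.disjoint_singleton_right]
    simp only [Set.mem_insert_iff, Set.mem_singleton_iff]
    rintro (h | h)
    · exact hvw h.symm
    · exact huw h.symm
  have hx : ∀ i, x i ∈ S.localAlgebra {v, u} := fun i =>
    S.localAlgebra_mono (by simp) (h.left_mem i)
  refine sub_eq_zero.1 (S.eq_zero_of_sum_mul_eq_zero' (a := fun i => P * x i - x i * P) hd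
    (fun i => sub_mem (mul_mem hP (hx i)) (mul_mem (hx i) hP)) h.right_mem h.linearIndependent
    ?_ i)
  have : ∀ i, (P * x i - x i * P) * y i = P * (x i * y i) - (x i * y i) * P := by
    intro i
    have := ((S.localAlgebra_superCommute hd) P hP _ (h.right_mem i)).1 heven
    rw [sub_mul, mul_assoc, mul_assoc, this, ← mul_assoc, ← mul_assoc]
  simp only [this, Finset.sum_sub_distrib]
  rw [← Finset.mul_sum, ← Finset.sum_mul, ← h.sum_eq, hcomm, sub_self]

/-- Moving `z` past `y i` leaves `z` on the right of an even term `x i * y i`, with the sign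
recorded by the grading. The commutator with `P` is again a combination of the independent `y i`, so
each coefficient vanishes. -/
theorem IsDecomposition.superCommute_left {S : FermionSystem V} {P : S.Op} {v w : V}
    (hvw : v ≠ w) {ι : Type*} [Fintype ι] {x y : ι → S.Op}
    (h : S.IsDecomposition P v w x y) {z : S.Op} (hz : z ∈ S.localAlgebra {v})
    (hcomm : P * z = z * P) (i : ι) :
    (S.grading z = z → z * x i = x i * z) ∧ (S.grading z = -z → z * x i = S.grading (x i) * z) := by
  have hd : Disjoint ({v} : Set V) {w} := Set.disjoint_singleton.2 hvw
  have hy : ∀ i, _ := fun i => S.localAlgebra_superCommute hd z hz _ (h.right_mem i)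
  have hmem : ∀ i, S.grading (x i) ∈ S.localAlgebra {v} := fun i =>
    S.localAlgebra_stable _ _ (h.left_mem i)
  constructor <;> intro hp
  · refine sub_eq_zero.1 (S.eq_zero_of_sum_mul_eq_zero' (a := fun i => z * x i - x i * z) hd
      (fun i => sub_mem (mul_mem hz (h.left_mem i)) (mul_mem (h.left_mem i) hz)) h.right_mem
      h.linearIndependent ?_ i)
    have : ∀ i, (z * x i - x i * z) * y i = z * (x i * y i) - (x i * y i) * z := by
      intro i
      rw [sub_mul, mul_assoc, mul_assoc, (hy i).1 hp, ← mul_assoc (x i)]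
    simp only [this, Finset.sum_sub_distrib]
    rw [← Finset.mul_sum, ← Finset.sum_mul, ← h.sum_eq, hcomm, sub_self]
  · refine sub_eq_zero.1 (S.eq_zero_of_sum_mul_eq_zero'
      (a := fun i => z * x i - S.grading (x i) * z) hd
      (fun i => sub_mem (mul_mem hz (h.left_mem i)) (mul_mem (hmem i) hz)) h.right_mem
      h.linearIndependent ?_ i)
    have : ∀ i, (z * x i - S.grading (x i) * z) * y i = z * (x i * y i) - (x i * y i) * z := by
      intro i
      rw [sub_mul, mul_assoc, mul_assoc, (hy i).2 hp, ← mul_assoc (S.grading (x i)), ← map_mul]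
      congr 2
      rcases h.parity_eq i with ⟨h0, h1⟩ | ⟨h0, h1⟩ <;> simp [h0, h1]
    simp only [this, Finset.sum_sub_distrib]
    rw [← Finset.mul_sum, ← Finset.sum_mul, ← h.sum_eq, hcomm, sub_self]

theorem grading_star_of_homogeneous (S : FermionSystem V) {x : S.Op}
    (h : S.grading x = x ∨ S.grading x = -x) :
    S.grading (star x) = star x ∨ S.grading (star x) = -star x := by
  rw [map_star]
  rcases h with h | h <;> rw [h]
  · exact .inl rfl
  · exact .inr (star_neg _)

theorem superCommute_pair_star (S : FermionSystem V) {z x : S.Op}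
    (h : (S.grading (star z) = star z → star z * x = x * star z) ∧
      (S.grading (star z) = -star z → star z * x = S.grading x * star z)) :
    (S.grading z = z → z * star x = star x * z) ∧
      (S.grading z = -z → z * star x = S.grading (star x) * z) := by
  constructor <;> intro hz
  · have := congrArg star (h.1 (by rw [map_star, hz]))
    simpa using this.symm
  · have := congrArg star (h.2 (by rw [map_star, hz, star_neg]))
    rw [star_mul, star_mul, star_star, ← map_star] at this
    have h2 := congrArg S.grading this
    rw [map_mul, map_mul, S.grading_grading, hz, mul_neg, neg_mul, neg_inj] at h2
    exact h2.symm

/-- The operators on the site `v` that occur in the decompositions of an edge operator, together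
with their adjoints. -/
theorem exists_site_generators (S : FermionSystem V) {P : S.Op} (e : Sym2 V) (p q : V)
    (he : e = s(p, q)) (hpq : p ≠ q) (hsupp : P ∈ S.localAlgebra {v | v ∈ e})
    (heven : S.grading P = P) :
    ∃ X : V → Set S.Op,
      (∀ v, ∀ x ∈ X v, x ∈ S.localAlgebra {v} ∧ (S.grading x = x ∨ S.grading x = -x) ∧
        star x ∈ X v) ∧
      (∀ v, v ∉ e → X v = ∅) ∧
      (∀ v w, v ≠ w → e = s(v, w) → ∃ (r s : ℕ) (x y : Fin r ⊕ Fin s → S.Op),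
        S.IsDecomposition P v w x y ∧ X v = Set.range x ∪ star '' Set.range x) ∧
      P ∈ Subalgebra.toSubmodule (Algebra.adjoin ℂ (X p)) *
        Subalgebra.toSubmodule (Algebra.adjoin ℂ (X q)) := by
  subst he
  have hset : {v | v ∈ s(p, q)} = ({p} : Set V) ∪ {q} := by
    ext v; simp [or_comm]
  rw [hset] at hsupp
  have hd : Disjoint ({p} : Set V) {q} := Set.disjoint_singleton.2 hpq
  obtain ⟨r, s, a, b, ha, hb, hpar, hsum, hla, hlb⟩ := exists_homogeneous_decomposition
    S.grading_grading (S.localAlgebra_stable {p}) (S.localAlgebra_stable {q})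
    (S.localAlgebra_union_le hd hsupp) heven
  have hdec : S.IsDecomposition P p q a b := ⟨ha, hb, hpar, hsum, hlb⟩
  have hgen : ∀ (v : V) (x : Fin r ⊕ Fin s → S.Op), (∀ i, x i ∈ S.localAlgebra {v}) →
      (∀ i, S.grading (x i) = x i ∨ S.grading (x i) = -x i) →
      ∀ z ∈ Set.range x ∪ star '' Set.range x, z ∈ S.localAlgebra {v} ∧
        (S.grading z = z ∨ S.grading z = -z) ∧ star z ∈ Set.range x ∪ star '' Set.range x := by
    rintro v x hx hxp z (⟨i, rfl⟩ | ⟨_, ⟨i, rfl⟩, rfl⟩)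
    · exact ⟨hx i, hxp i, .inr ⟨_, ⟨i, rfl⟩, rfl⟩⟩
    · exact ⟨S.star_mem_localAlgebra _ _ (hx i), S.grading_star_of_homogeneous (hxp i),
        .inl ⟨i, (star_star _).symm⟩⟩
  have hXp : ∀ (B C D : Set S.Op), (if p = p then B else if p = q then C else D) = B :=
    fun _ _ _ => if_pos rfl
  have hXq : ∀ (B C D : Set S.Op), (if q = p then B else if q = q then C else D) = C :=
    fun _ _ _ => by rw [if_neg hpq.symm, if_pos rfl]
  refine ⟨fun v => if v = p then Set.range a ∪ star '' Set.range a else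
    if v = q then Set.range b ∪ star '' Set.range b else ∅, ?_, ?_, ?_, ?_⟩
  · intro v z hz
    dsimp only at hz ⊢
    by_cases hvp : v = p
    · subst hvp
      rw [hXp] at hz ⊢
      exact hgen v a ha (fun i => (hpar i).imp And.left And.left) z hz
    · by_cases hvq : v = q
      · subst hvq
        rw [hXq] at hz ⊢
        exact hgen v b hb (fun i => (hpar i).imp And.right And.right) z hz
      · simp [hvp, hvq] at hz
  · intro v hv
    simp only [Sym2.mem_iff, not_or] at hv
    simp [hv.1, hv.2]
  · intro v w hvw hevw
    rcases Sym2.eq_iff.1 hevw with ⟨rfl, rfl⟩ | ⟨rfl, rfl⟩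
    · exact ⟨r, s, a, b, hdec, hXp _ _ _⟩
    · exact ⟨r, s, b, _, hdec.swap hpq hla, hXq _ _ _⟩
  · dsimp only
    rw [hXp, hXq, hsum]
    exact sum_mem fun i _ => Submodule.mul_mem_mul
      (Algebra.subset_adjoin (.inl ⟨i, rfl⟩)) (Algebra.subset_adjoin (.inl ⟨i, rfl⟩))

/-- Each commuting edge operator is built from graded algebras on its end points, and all these
algebras supercommute. -/
theorem exists_site_algebras (S : FermionSystem V) (G : SimpleGraph V) (P : G.edgeSet → S.Op)
    (hstar : ∀ e, star (P e) = P e)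
    (hsupp : ∀ e, P e ∈ S.localAlgebra (FermionSystem.ends e))
    (heven : ∀ e, S.grading (P e) = P e) (hcomm : ∀ e f, Commute (P e) (P f)) :
    ∃ (p q : G.edgeSet → V) (N : G.edgeSet → V → Subalgebra ℂ S.Op),
      (∀ e : G.edgeSet, (e : Sym2 V) = s(p e, q e)) ∧ (∀ e, p e ≠ q e) ∧
      (∀ e v, N e v ≤ S.localAlgebra {v}) ∧
      (∀ e v, ∀ x ∈ N e v, S.grading x ∈ N e v) ∧
      (∀ e v, ∀ x ∈ N e v, star x ∈ N e v) ∧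
      (∀ e v f w, (e, v) ≠ (f, w) → SuperCommute S.grading (N e v : Set S.Op) (N f w)) ∧
      ∀ e, P e ∈ Subalgebra.toSubmodule (N e (p e)) * Subalgebra.toSubmodule (N e (q e)) := by
  have hends : ∀ e : G.edgeSet, ∃ p q : V, (e : Sym2 V) = s(p, q) ∧ p ≠ q := by
    rintro ⟨e, he⟩
    induction e using Sym2.ind with
    | _ p q => exact ⟨p, q, rfl, G.ne_of_adj he⟩
  choose p q hpq hne using hends
  have hX := fun e : G.edgeSet => S.exists_site_generators (e : Sym2 V) (p e) (q e) (hpq e) (hne e) (hsupp e)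
    (heven e)
  choose X hX1 hX2 hX3 hX4 using hX
  refine ⟨p, q, fun e v => Algebra.adjoin ℂ (X e v), hpq, hne,
    fun e v => Algebra.adjoin_le fun x hx => (hX1 e v x hx).1,
    fun e v => adjoin_stable fun x hx => (hX1 e v x hx).2.1,
    fun e v => adjoin_star_mem fun x hx => (hX1 e v x hx).2.2, ?_, hX4⟩
  intro e v f w hef
  refine SuperCommute.adjoin S.grading_grading ?_ (fun x hx => (hX1 e v x hx).2.1)
    (fun x hx => (hX1 f w x hx).2.1)
  -- Different sites supercommute by locality. Only two edges meeting at one site require that the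
  -- edge operators commute.
  by_cases hvw : v = w
  · subst hvw
    have hef' : e ≠ f := fun h => hef (by rw [h])
    by_cases hve : v ∈ (e : Sym2 V)
    swap
    · rw [hX2 e v hve]; intro x hx; exact absurd hx (Set.notMem_empty x)
    by_cases hvf : v ∈ (f : Sym2 V)
    swap
    · rw [hX2 f v hvf]; intro _ _ x hx; exact absurd hx (Set.notMem_empty x)
    obtain ⟨u, hu⟩ := Sym2.mem_iff_exists.1 hve
    obtain ⟨w, hw⟩ := Sym2.mem_iff_exists.1 hvf
    have huv : v ≠ u := by
      have := e.2; rw [hu] at this; exact G.ne_of_adj this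
    have hwv : v ≠ w := by
      have := f.2; rw [hw] at this; exact G.ne_of_adj this
    have huw : u ≠ w := by
      rintro rfl; exact hef' (Subtype.ext (hu.trans hw.symm))
    obtain ⟨r, s, x, y, hxy, hXe⟩ := hX3 e v u huv hu
    obtain ⟨r', s', c, d, hcd, hXf⟩ := hX3 f v w hwv hw
    have hends : ends f = {v, w} := by
      ext z; simp only [ends, hw]; simp
    -- the generators at `f` and their adjoints supercommute with the first factors at `e`
    have hcomm' : ∀ z ∈ X e v, P f * z = z * P f := by
      intro z hz
      have h1 : ∀ i, P f * x i = x i * P f := fun i => hxy.commute_left huw.symm huv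
        (by rw [← hends]; exact hsupp f) (heven f) (hcomm f e).eq i
      rw [hXe] at hz
      rcases hz with ⟨i, rfl⟩ | ⟨_, ⟨i, rfl⟩, rfl⟩
      · exact h1 i
      · have := congrArg star (h1 i)
        rw [star_mul, star_mul, hstar] at this
        exact this.symm
    intro z hz t ht
    rw [hXf] at ht
    rcases ht with ⟨i, rfl⟩ | ⟨_, ⟨i, rfl⟩, rfl⟩
    · exact hcd.superCommute_left hwv (hX1 e v z hz).1 (hcomm' z hz) i
    · have hz' := (hX1 e v z hz).2.2
      exact S.superCommute_pair_star
        (hcd.superCommute_left hwv (hX1 e v _ hz').1 (hcomm' _ hz') i)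
  · exact (S.localAlgebra_superCommute (Set.disjoint_singleton.2 hvw)).mono
      (fun x hx => (hX1 e v x hx).1) (fun x hx => (hX1 f w x hx).1)

end FermionSystem

/-! ### Minimal projections in star-algebras of matrices. -/

section MatrixAlgebra

variable {m : Type*} [Fintype m] [DecidableEq m]

/-- Spectral projections of a self-adjoint matrix lie in every algebra that contains it. -/
theorem Matrix.exists_spectral_projection (B : Subalgebra ℂ (Matrix m m ℂ)) {y : Matrix m m ℂ}
    (hy : y ∈ B) (hsa : IsSelfAdjoint y) (hne : y ≠ 0) :
    ∃ (E : Matrix m m ℂ) (t : ℝ), E ∈ B ∧ IsStarProjection E ∧ E ≠ 0 ∧ t ≠ 0 ∧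
      y * E = (t : ℂ) • E := by
  have hH : y.IsHermitian := hsa
  obtain ⟨i, hi⟩ : ∃ i, hH.eigenvalues i ≠ 0 := by
    by_contra! h
    exact hne (hH.eigenvalues_eq_zero_iff.1 (funext h))
  have : Nonempty m := ⟨i⟩
  set t := hH.eigenvalues i with ht
  have hspec : t ∈ spectrum ℝ y := hH.eigenvalues_mem_spectrum_real i
  have hfin : (spectrum ℝ y).Finite := Matrix.finite_real_spectrum
  set f : ℝ → ℝ := fun s => if s = t then 1 else 0 with hf
  have hcont : ∀ g : ℝ → ℝ, ContinuousOn g (spectrum ℝ y) := fun g => hfin.continuousOn g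
  refine ⟨cfc f y, t, ?_, ?_, ?_, hi, ?_⟩
  -- The spectrum is finite, so the indicator function of `t` agrees on it with a polynomial. The
  -- projection is thus a polynomial in `y` and stays in `B`.
  · have hq : cfc f y = cfc (Lagrange.interpolate hfin.toFinset id f).eval y := by
      refine cfc_congr fun s hs => ?_
      exact (Lagrange.eval_interpolate_at_node f (fun _ _ _ _ h => h)
        (hfin.mem_toFinset.2 hs)).symm
    rw [hq, cfc_polynomial _ y hsa]
    have hle : Algebra.adjoin ℝ {y} ≤ B.restrictScalars ℝ :=
      Algebra.adjoin_le (Set.singleton_subset_iff.2 hy)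
    exact hle (Polynomial.aeval_mem_adjoin_singleton ℝ y)
  · refine ⟨?_, cfc_predicate f y⟩
    rw [IsIdempotentElem, ← cfc_mul f f y (hcont _) (hcont _)]
    congr 1
    funext s
    simp [hf]
  · intro h0
    have := cfc_map_spectrum f y (hf := hcont _) (ha := hsa)
    rw [h0, spectrum.zero_eq] at this
    have h1 : f t ∈ f '' spectrum ℝ y := ⟨t, hspec, rfl⟩
    rw [← this] at h1
    simp [hf] at h1
  · have h1 : y * cfc f y = cfc (fun s => s * f s) y := by
      rw [cfc_mul (fun s => s) f y (hcont _) (hcont _), cfc_id' ℝ y]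
    have h2 : cfc (fun s => s * f s) y = cfc (fun s => t • f s) y := by
      congr 1
      funext s
      by_cases h : s = t <;> simp [hf, h]
    rw [h1, h2, cfc_smul t f y (hcont _)]
    ext a b
    simp

theorem Matrix.rank_lt_of_proper {E p : Matrix m m ℂ} (hE : E * E = E) (h1 : p * E = E)
    (h2 : E * p = E) (hne : E ≠ p) : E.rank < p.rank := by
  have hle : LinearMap.range E.mulVecLin ≤ LinearMap.range p.mulVecLin := by
    rintro _ ⟨v, rfl⟩
    exact ⟨E *ᵥ v, by simp [h1]⟩
  refine Submodule.finrank_lt_finrank_of_lt (lt_of_le_of_ne hle fun heq => hne ?_)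
  have hEp : E * p = p := by
    refine Matrix.toLin'.injective (LinearMap.ext fun v => ?_)
    have : p.mulVecLin v ∈ LinearMap.range E.mulVecLin := by
      rw [heq]; exact ⟨v, rfl⟩
    obtain ⟨w, hw⟩ := this
    simp only [Matrix.mulVecLin_apply] at hw
    rw [Matrix.toLin'_apply, Matrix.toLin'_apply, ← Matrix.mulVec_mulVec, ← hw,
      Matrix.mulVec_mulVec, hE]
  rw [← h2, hEp]

/-- `e` is minimal in `B`: the corner `e B e` consists of the multiples of `e`. -/
def IsMinimalIn {A : Type*} [Ring A] [Algebra ℂ A] (B : Subalgebra ℂ A) (e : A) : Prop :=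
  ∀ x ∈ B, ∃ c : ℂ, e * x * e = c • e

/-- Every projection in a self-adjoint algebra of matrices is a sum of orthogonal minimal ones. -/
theorem Matrix.exists_minimal_family (B : Subalgebra ℂ (Matrix m m ℂ))
    (hB : ∀ x ∈ B, star x ∈ B) (p : Matrix m m ℂ) (hp : p ∈ B) (hproj : IsStarProjection p) :
    ∃ (r : ℕ) (e : Fin r → Matrix m m ℂ),
      (∀ a, e a ∈ B ∧ IsStarProjection (e a) ∧ IsMinimalIn B (e a)) ∧
      (∀ a b, a ≠ b → e a * e b = 0) ∧ ∑ a, e a = p := by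
  induction hr : p.rank using Nat.strong_induction_on generalizing p with
  | _ n ih =>
  subst hr
  by_cases hmin : IsMinimalIn B p
  · refine ⟨1, fun _ => p, fun _ => ⟨hp, hproj, hmin⟩, ?_, by simp⟩
    intro a b hab
    exact absurd (Subsingleton.elim a b) hab
  have hpp : p * p = p := hproj.isIdempotentElem.eq
  have hps : star p = p := hproj.isSelfAdjoint.star_eq
  -- Failure of minimality is seen by a self-adjoint element: if the real and imaginary parts of
  -- every `x` compressed to scalars, so would `x`.
  obtain ⟨y, hyB, hys, hy⟩ : ∃ y ∈ B, IsSelfAdjoint y ∧ ∀ c : ℂ, p * y * p ≠ c • p := by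
    by_contra! h
    refine hmin fun x hx => ?_
    obtain ⟨c, hc⟩ := h (x + star x) (add_mem hx (hB x hx)) (IsSelfAdjoint.add_star_self x)
    obtain ⟨d, hd⟩ := h (Complex.I • (x - star x))
      (Subalgebra.smul_mem _ (sub_mem hx (hB x hx)) _) (by
        rw [isSelfAdjoint_iff, star_smul, star_sub, star_star]
        simp only [RCLike.star_def, Complex.conj_I, neg_smul, ← smul_neg, neg_sub])
    refine ⟨(1 / 2) * c - (1 / 2) * Complex.I * d, ?_⟩
    have hx2 : x = (1 / 2 : ℂ) • (x + star x) -
        ((1 / 2) * Complex.I) • (Complex.I • (x - star x)) := by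
      rw [smul_smul, mul_assoc, Complex.I_mul_I]; module
    conv_lhs => rw [hx2]
    rw [mul_sub, sub_mul, mul_smul_comm _ p, mul_smul_comm _ p, smul_mul_assoc, smul_mul_assoc, hc,
      hd, smul_smul, smul_smul, ← sub_smul]
  have hzB : p * y * p ∈ B := mul_mem (mul_mem hp hyB) hp
  have hzs : IsSelfAdjoint (p * y * p) := by
    rw [isSelfAdjoint_iff, star_mul, star_mul, hps, hys.star_eq, mul_assoc]
  obtain ⟨E, t, hEB, hE, hE0, ht, hyE⟩ := Matrix.exists_spectral_projection B hzB hzs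
    (by simpa using hy 0)
  have ht' : (t : ℂ) ≠ 0 := by exact_mod_cast ht
  have hEE : E * E = E := hE.isIdempotentElem.eq
  have hEs : star E = E := hE.isSelfAdjoint.star_eq
  have hpE : p * E = E := by
    have h1 : E = (t : ℂ)⁻¹ • (p * y * p * E) := by rw [hyE, smul_smul, inv_mul_cancel₀ ht', one_smul]
    rw [h1, mul_smul_comm]
    simp only [← mul_assoc, hpp]
  have hEp : E * p = E := by
    have := congrArg star hpE
    rwa [star_mul, hps, hEs] at this
  -- `E = p` would give `p * y * p = t • p`, against the choice of `y`. Hence `E` and `p - E` are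
  -- both of smaller rank than `p`.
  have hEne : E ≠ p := by
    rintro rfl
    refine hy t ?_
    rw [← hyE, mul_assoc _ E E, hEE]
  have hF : IsStarProjection (p - E) := by
    refine ⟨?_, hproj.isSelfAdjoint.sub hE.isSelfAdjoint⟩
    rw [IsIdempotentElem, sub_mul, mul_sub, mul_sub, hpp, hpE, hEp, hEE]; simp
  have hEF : E * (p - E) = 0 := by rw [mul_sub, hEp, hEE, sub_self]
  have hFE : (p - E) * E = 0 := by rw [sub_mul, hpE, hEE, sub_self]
  obtain ⟨r, e, he, heo, hes⟩ := ih _ (Matrix.rank_lt_of_proper hEE hpE hEp hEne) E hEB hE rfl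
  obtain ⟨s, f, hf, hfo, hfs⟩ := ih _ (Matrix.rank_lt_of_proper (p := p)
    hF.isIdempotentElem.eq (by rw [mul_sub, hpp, hpE]) (by rw [sub_mul, hpp, hEp])
    (by simpa using hE0)) (p - E) (sub_mem hp hEB) hF rfl
  have heE : ∀ a, e a * E = e a ∧ E * e a = e a := by
    intro a
    rw [← hes, Finset.mul_sum, Finset.sum_mul]
    constructor <;> rw [Finset.sum_eq_single a]
    all_goals first
      | exact (he a).2.1.isIdempotentElem.eq
      | exact fun b _ hb => heo _ _ hb
      | exact fun b _ hb => heo _ _ hb.symm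
      | simp
  have hfF : ∀ a, f a * (p - E) = f a ∧ (p - E) * f a = f a := by
    intro a
    rw [← hfs, Finset.mul_sum, Finset.sum_mul]
    constructor <;> rw [Finset.sum_eq_single a]
    all_goals first
      | exact (hf a).2.1.isIdempotentElem.eq
      | exact fun b _ hb => hfo _ _ hb
      | exact fun b _ hb => hfo _ _ hb.symm
      | simp
  refine ⟨r + s, Fin.append e f, ?_, ?_, ?_⟩
  · intro a; refine Fin.addCases (fun a => ?_) (fun a => ?_) a <;> simp [he, hf]
  · intro a b
    refine Fin.addCases (fun a => ?_) (fun a => ?_) a <;>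
      refine Fin.addCases (fun b => ?_) (fun b => ?_) b <;> intro hab <;>
      simp only [Fin.append_left, Fin.append_right]
    · exact heo _ _ fun h => hab (by rw [h])
    · rw [← (heE a).1, ← (hfF b).2, mul_assoc, ← mul_assoc E, hEF, zero_mul, mul_zero]
    · rw [← (hfF a).1, ← (heE b).2, mul_assoc, ← mul_assoc (p - E), hFE, zero_mul, mul_zero]
    · exact hfo _ _ fun h => hab (by rw [h])
  · simp [Fin.sum_univ_add, hes, hfs]

-- Taking traces exhibits `c` as a ratio of positive numbers. The form `r ^ 2` is what is needed to
-- normalize `x` to a partial isometry.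
open scoped ComplexOrder in
theorem Matrix.exists_pos_of_star_mul_self {x p : Matrix m m ℂ} {c : ℂ} (hp : IsStarProjection p)
    (hx : x ≠ 0) (h : star x * x = c • p) : ∃ r : ℝ, 0 < r ∧ c = (r : ℂ) ^ 2 := by
  have htr : (xᴴ * x).trace = c * (pᴴ * p).trace := by
    rw [← Matrix.star_eq_conjTranspose, ← Matrix.star_eq_conjTranspose, h,
      hp.isSelfAdjoint.star_eq, hp.isIdempotentElem.eq, Matrix.trace_smul, smul_eq_mul]
  have hnn : ∀ z : Matrix m m ℂ, z ≠ 0 → 0 < (zᴴ * z).trace := fun z hz =>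
    lt_of_le_of_ne ((Matrix.posSemidef_conjTranspose_mul_self z).trace_nonneg)
      fun h => hz (Matrix.trace_conjTranspose_mul_self_eq_zero_iff.1 h.symm)
  have hp0 : p ≠ 0 := by
    rintro rfl
    rw [smul_zero] at h
    exact hx (Matrix.conjTranspose_mul_self_eq_zero.1 h)
  have h1 := hnn x hx
  have h2 := hnn p hp0
  rw [htr] at h1
  have hc : 0 < c := pos_of_mul_pos_left h1 h2.le
  obtain ⟨h3, h4⟩ := Complex.lt_def.1 hc
  refine ⟨Real.sqrt c.re, Real.sqrt_pos.2 h3, ?_⟩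
  rw [← Complex.ofReal_pow, Real.sq_sqrt h3.le]
  exact Complex.ext rfl h4.symm

end MatrixAlgebra

/-! ### Reflections that align a projection with minimal projections. -/

section Reflection

/-- A partial isometry `v` with `v v* = g` and `v g = c g` yields a reflection that takes `g`
to `v* v`. -/
theorem exists_reflection_of_partialIsometry {A : Type*} [Ring A] [Algebra ℂ A] [StarRing A]
    [StarModule ℂ A] {g v : A} {c : ℂ} (hc : 1 + c ≠ 0) (hcs : star c = c) (hgg : g * g = g)
    (hgs : star g = g) (hvw : v * star v = g) (hvg : v * g = c • g) (hgv : g * v = v) :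
    ∃ R ∈ Algebra.adjoin ℂ {g, v, star v}, star R = R ∧ R * R = 1 ∧ R * g = star v ∧
      ∀ h, h * g = 0 → g * h = 0 → h * star v = 0 → v * h = 0 → Commute R h := by
  obtain ⟨w, hw⟩ : ∃ w, w = star v := ⟨_, rfl⟩
  rw [← hw] at hvw ⊢
  have hwg : w * g = w := by rw [hw, ← hgs, ← star_mul, hgv]
  have hgw : g * w = c • g := by
    have := congrArg star hvg
    rwa [star_mul, star_smul, hgs, hcs, ← hw] at this
  have hvv : v * v = c • v := by
    calc v * v = (v * g) * v := by rw [mul_assoc, hgv]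
      _ = c • v := by rw [hvg, smul_mul_assoc, hgv]
  have hww : w * w = c • w := by
    have := congrArg star hvv
    rwa [star_mul, star_smul, hcs, ← hw] at this
  have e2 : ∀ z, v * (w * z) = g * z := fun z => by rw [← mul_assoc, hvw]
  have e6 : ∀ z, g * (w * z) = c • (g * z) := fun z => by rw [← mul_assoc, hgw, smul_mul_assoc]
  have e8 : ∀ z, w * (w * z) = c • (w * z) := fun z => by rw [← mul_assoc, hww, smul_mul_assoc]
  -- `K = (g + w)(g + w)*`, while `(g + w)*(g + w) = 2 (1 + c) g`. So `K / (2 (1 + c))` is a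
  -- projection and `K / (1 + c) - 1` is the reflection about its range. In rank one this is the
  -- reflection about the bisector of two unit vectors with inner product `c`.
  obtain ⟨K, hK⟩ : ∃ K, K = g + w * v + v + w := ⟨_, rfl⟩
  obtain ⟨s, hs⟩ : ∃ s : ℂ, s * (1 + c) = 1 := ⟨(1 + c)⁻¹, inv_mul_cancel₀ hc⟩
  have hss : star s = s := by
    have h1 := congrArg star hs
    rw [star_mul, star_add, hcs, star_one] at h1
    calc star s = (s * (1 + c)) * star s := by rw [hs, one_mul]
      _ = s * ((1 + c) * star s) := by ring
      _ = s := by rw [h1, mul_one]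
  have hKK : K * K = (2 * (1 + c)) • K := by
    rw [hK]
    simp only [mul_add, add_mul, mul_assoc, hgg, hvw, hvg, hgv, hwg, hgw, hvv, hww, e2, e6,
      e8, mul_smul_comm, smul_add]
    module
  have hKs : star K = K := by
    have hws : star w = v := by rw [hw, star_star]
    rw [hK, star_add, star_add, star_add, star_mul, hgs, ← hw, hws]
    abel
  have hKg : K * g = (1 + c) • (g + w) := by
    rw [hK]
    simp only [add_mul, mul_assoc, hgg, hvg, hwg, mul_smul_comm]
    module
  refine ⟨s • K - 1, ?_, ?_, ?_, ?_, ?_⟩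
  · have hg' : g ∈ Algebra.adjoin ℂ {g, v, w} := Algebra.subset_adjoin (by simp)
    have hv' : v ∈ Algebra.adjoin ℂ {g, v, w} := Algebra.subset_adjoin (by simp)
    have hw' : w ∈ Algebra.adjoin ℂ {g, v, w} := Algebra.subset_adjoin (by simp)
    rw [hK]
    exact sub_mem (Subalgebra.smul_mem _ (add_mem (add_mem (add_mem hg' (mul_mem hw' hv')) hv') hw')
      _) (one_mem _)
  · rw [star_sub, star_smul, hKs, hss, star_one]
  · rw [sub_mul, mul_sub, smul_mul_smul_comm, hKK, smul_smul, mul_one, one_mul,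
      show s * s * (2 * (1 + c)) = 2 * s by linear_combination 2 * s * hs]
    module
  · rw [sub_mul, smul_mul_assoc, hKg, smul_smul, hs]; simp
  · intro h h1 h2 h3 h4
    have h5 : h * v = 0 := by rw [← hgv, ← mul_assoc, h1, zero_mul]
    have h6 : w * h = 0 := by rw [← hwg, mul_assoc, h2, mul_zero]
    have h7 : K * h = 0 := by
      rw [hK]; simp only [add_mul, mul_assoc, h2, h4, h6, mul_zero, add_zero]
    have h8 : h * K = 0 := by
      rw [hK]; simp only [mul_add, ← mul_assoc, h1, h3, h5, zero_mul, add_zero]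
    rw [Commute, SemiconjBy, sub_mul, mul_sub, smul_mul_assoc, mul_smul_comm, h7, h8, one_mul,
      mul_one]

end Reflection

section MatrixAlgebra

variable {m : Type*} [Fintype m] [DecidableEq m]

/-- For a projection `P` and a minimal projection `g` there is a reflection `R` such that
`R P R` commutes with `g`. -/
theorem Matrix.exists_reflection (B : Subalgebra ℂ (Matrix m m ℂ)) {g P : Matrix m m ℂ}
    (hg : g ∈ B) (hgp : IsStarProjection g) (hmin : IsMinimalIn B g) (hP : P ∈ B)
    (hPp : IsStarProjection P) :
    ∃ R ∈ B, star R = R ∧ R * R = 1 ∧ Commute (R * P * R) g ∧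
      ∀ h, Commute h P → h * g = 0 → g * h = 0 → Commute R h := by
  have hgg : g * g = g := hgp.isIdempotentElem.eq
  have hgs : star g = g := hgp.isSelfAdjoint.star_eq
  have hPP : P * P = P := hPp.isIdempotentElem.eq
  have hPs : star P = P := hPp.isSelfAdjoint.star_eq
  by_cases hPg : P * g = 0
  · refine ⟨1, one_mem _, star_one _, one_mul _, ?_, fun h _ _ _ => Commute.one_left h⟩
    have := congrArg star hPg
    rw [star_mul, hgs, hPs, star_zero] at this
    rw [one_mul, mul_one, Commute, SemiconjBy, hPg, this]
  obtain ⟨t, ht⟩ := hmin P hP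
  obtain ⟨r, hr, htr⟩ := Matrix.exists_pos_of_star_mul_self (x := P * g) hgp hPg (c := t) (by
    rw [star_mul, hgs, hPs, ← ht, mul_assoc, ← mul_assoc P, hPP, mul_assoc])
  obtain ⟨c, hc⟩ : ∃ c : ℂ, c = r := ⟨_, rfl⟩
  have hc0 : c ≠ 0 := by rw [hc]; exact_mod_cast hr.ne'
  have hc1 : 1 + c ≠ 0 := by rw [hc]; exact_mod_cast (by linarith : (1 : ℝ) + r ≠ 0)
  have hcs : star c = c := by rw [hc]; simp
  have hcs' : star c⁻¹ = c⁻¹ := by rw [star_inv₀, hcs]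
  rw [← hc] at htr
  subst htr
  have hstar : star (c⁻¹ • (g * P)) = c⁻¹ • (P * g) := by
    rw [star_smul, star_mul, hgs, hPs, hcs']
  -- With `g P g = c ^ 2 g`, `v = c⁻¹ g P` satisfies `v v* = g` and `v g = c g`. Its initial
  -- projection `v* v` lies below `P`; since `R` carries `g` there, `R P R` fixes `g`.
  obtain ⟨R, hR, hRs, hRR, hRg, hRc⟩ := exists_reflection_of_partialIsometry
    (g := g) (v := c⁻¹ • (g * P)) hc1 hcs hgg hgs
    (by
      rw [hstar, smul_mul_smul_comm, mul_assoc, ← mul_assoc P, hPP, ← mul_assoc, ht, smul_smul,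
        show c⁻¹ * c⁻¹ * c ^ 2 = 1 by field_simp, one_smul])
    (by
      rw [smul_mul_assoc, ht, smul_smul, show c⁻¹ * c ^ 2 = c by field_simp])
    (by rw [mul_smul_comm, ← mul_assoc, hgg])
  rw [hstar] at hR hRg hRc
  have hRB : R ∈ B := by
    refine Algebra.adjoin_le ?_ hR
    rintro x (rfl | rfl | rfl)
    · exact hg
    · exact Subalgebra.smul_mem _ (mul_mem hg hP) _
    · exact Subalgebra.smul_mem _ (mul_mem hP hg) _
  refine ⟨R, hRB, hRs, hRR, ?_, fun h hh h1 h2 => hRc h h1 h2 ?_ ?_⟩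
  · have h1 : R * P * R * g = g := by
      rw [mul_assoc, hRg, mul_assoc, mul_smul_comm, ← mul_assoc, hPP, ← hRg, ← mul_assoc, hRR,
        one_mul]
    have h2 := congrArg star h1
    simp only [star_mul, hgs, hRs, hPs] at h2
    rw [Commute, SemiconjBy, h1, mul_assoc R, h2]
  · rw [mul_smul_comm, ← mul_assoc, hh.eq, mul_assoc, h1, mul_zero, smul_zero]
  · rw [smul_mul_assoc, mul_assoc, ← hh.eq, ← mul_assoc, h2, zero_mul, smul_zero]

/-- A projection can be conjugated by a unitary so as to commute with a given family of orthogonal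
minimal projections. -/
theorem Matrix.exists_unitary_commute (B : Subalgebra ℂ (Matrix m m ℂ))
    (hB : ∀ x ∈ B, star x ∈ B) {ι : Type*} (g : ι → Matrix m m ℂ)
    (hg : ∀ a, g a ∈ B) (hgp : ∀ a, IsStarProjection (g a)) (hmin : ∀ a, IsMinimalIn B (g a))
    (horth : ∀ a b, a ≠ b → g a * g b = 0) {P : Matrix m m ℂ} (hP : P ∈ B)
    (hPp : IsStarProjection P) (s : Finset ι) :
    ∃ U ∈ B, U ∈ unitary (Matrix m m ℂ) ∧ ∀ a ∈ s, Commute (star U * P * U) (g a) := by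
  classical
  induction s using Finset.induction_on with
  | empty => exact ⟨1, one_mem _, one_mem _, by simp⟩
  | insert a s ha ih =>
    obtain ⟨U, hUB, hU, hUc⟩ := ih
    have hUU : U * star U = 1 := Unitary.mul_star_self_of_mem hU
    have hP' : IsStarProjection (star U * P * U) := by
      refine ⟨?_, ?_⟩
      · rw [IsIdempotentElem, mul_assoc, mul_assoc, ← mul_assoc U, ← mul_assoc U, hUU, one_mul,
          ← mul_assoc P, hPp.isIdempotentElem.eq, ← mul_assoc]
      · rw [isSelfAdjoint_iff, star_mul, star_mul, star_star, hPp.isSelfAdjoint.star_eq, mul_assoc]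
    obtain ⟨R, hRB, hRs, hRR, hRa, hRc⟩ := Matrix.exists_reflection B (hg a) (hgp a) (hmin a)
      (mul_mem (mul_mem (hB U hUB) hP) hUB) hP'
    have hconj : star (U * R) * P * (U * R) = R * (star U * P * U) * R := by
      rw [star_mul, hRs]; simp only [mul_assoc]
    refine ⟨U * R, mul_mem hUB hRB, mul_mem hU ?_, ?_⟩
    · rw [Unitary.mem_iff, hRs]; exact ⟨hRR, hRR⟩
    · intro b hb
      rw [hconj]
      rcases Finset.mem_insert.1 hb with rfl | hb
      · exact hRa
      · have hab : a ≠ b := by rintro rfl; exact ha hb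
        -- The projections already treated commute with the current conjugate of `P` and are
        -- orthogonal to `g a`, so the new reflection leaves them alone.
        have hRb : Commute R (g b) := hRc _ (hUc b hb).symm (horth _ _ hab.symm) (horth _ _ hab)
        exact (hRb.mul_left (hUc b hb)).mul_left hRb

/-! ### Corners of graded algebras at minimal even projections. -/

/-- The even part of an algebra. -/
def evenSubalgebra {A : Type*} [Ring A] [Algebra ℂ A] [StarRing A] [StarModule ℂ A]
    (α : A ≃⋆ₐ[ℂ] A) (N : Subalgebra ℂ A) : Subalgebra ℂ A :=
  (Subalgebra.toSubmodule N ⊓ evenSubmodule α).toSubalgebra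
    ⟨one_mem N, map_one α⟩
    (fun x y hx hy => ⟨mul_mem (S := Subalgebra ℂ A) hx.1 hy.1, by
      have h1 : α x = x := hx.2
      have h2 : α y = y := hy.2
      change α (x * y) = x * y
      rw [map_mul, h1, h2]⟩)

theorem mem_evenSubalgebra {A : Type*} [Ring A] [Algebra ℂ A] [StarRing A]
    [StarModule ℂ A] {α : A ≃⋆ₐ[ℂ] A} {N : Subalgebra ℂ A} {x : A} : x ∈ evenSubalgebra α N ↔ x ∈ N ∧ α x = x := Iff.rfl

/-- The corner of a graded algebra at a minimal even projection `e` is spanned by `e` and at most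
one self-adjoint odd element, which squares to `e`. -/
theorem Matrix.exists_odd_corner (α : Matrix m m ℂ ≃⋆ₐ[ℂ] Matrix m m ℂ)
    (hα : ∀ x, α (α x) = x) (N : Subalgebra ℂ (Matrix m m ℂ)) (hN : ∀ x ∈ N, star x ∈ N)
    (hNα : ∀ x ∈ N, α x ∈ N) {e : Matrix m m ℂ} (he : e ∈ evenSubalgebra α N)
    (hep : IsStarProjection e) (hmin : IsMinimalIn (evenSubalgebra α N) e) :
    ∃ τ ∈ N, α τ = -τ ∧ star τ = τ ∧ e * τ = τ ∧ τ * e = τ ∧ (τ = 0 ∨ τ * τ = e) ∧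
      ∀ x ∈ N, ∃ c d : ℂ, e * x * e = c • e + d • τ := by
  obtain ⟨heN, heα⟩ := mem_evenSubalgebra.1 he
  have hee : e * e = e := hep.isIdempotentElem.eq
  have hes : star e = e := hep.isSelfAdjoint.star_eq
  suffices h : ∃ τ ∈ N, α τ = -τ ∧ star τ = τ ∧ e * τ = τ ∧ τ * e = τ ∧ (τ = 0 ∨ τ * τ = e) ∧
      ∀ x ∈ N, α x = -x → ∃ d : ℂ, e * x * e = d • τ by
    obtain ⟨τ, h1, h2, h3, h4, h5, h6, h7⟩ := h
    refine ⟨τ, h1, h2, h3, h4, h5, h6, fun x hx => ?_⟩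
    obtain ⟨c, hc⟩ := hmin (evenPart α x) ⟨evenPart_mem (B := Subalgebra.toSubmodule N) hNα hx,
      map_evenPart hα x⟩
    obtain ⟨d, hd⟩ := h7 (oddPart α x) (oddPart_mem (B := Subalgebra.toSubmodule N) hNα hx)
      (map_oddPart hα x)
    refine ⟨c, d, ?_⟩
    rw [← hc, ← hd, ← add_mul, ← mul_add, evenPart_add_oddPart]
  by_cases hall : ∀ x ∈ N, α x = -x → e * x * e = 0
  · exact ⟨0, zero_mem _, by simp, star_zero _, mul_zero _, zero_mul _, .inl rfl,
      fun x hx hx' => ⟨0, by rw [hall x hx hx', smul_zero]⟩⟩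
  push Not at hall
  obtain ⟨h, hhN, hhα, hhs, hh0⟩ : ∃ h ∈ N, α h = -h ∧ star h = h ∧ e * h * e ≠ 0 := by
    obtain ⟨x, hx, hxα, hx0⟩ := hall
    by_contra! hcon
    have hsα : α (star x) = -star x := by rw [map_star, hxα, star_neg]
    have h1 := hcon (x + star x) (add_mem hx (hN x hx)) (by rw [map_add, hxα, hsα]; abel)
      (by rw [star_add, star_star, add_comm])
    have h2 := hcon (Complex.I • (x - star x)) (Subalgebra.smul_mem _ (sub_mem hx (hN x hx)) _)
      (by rw [map_smul, map_sub, hxα, hsα, ← smul_neg]; congr 1; abel)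
      (by
        rw [star_smul, star_sub, star_star]
        simp only [RCLike.star_def, Complex.conj_I, neg_smul, ← smul_neg, neg_sub])
    refine hx0 ?_
    have hx2 : x = (1 / 2 : ℂ) • (x + star x) -
        ((1 / 2) * Complex.I) • (Complex.I • (x - star x)) := by
      rw [smul_smul, mul_assoc, Complex.I_mul_I]; module
    rw [hx2, mul_sub, sub_mul, mul_smul_comm _ e, mul_smul_comm _ e, smul_mul_assoc,
      smul_mul_assoc, h1, h2, smul_zero, smul_zero, sub_zero]
  obtain ⟨k, hk⟩ : ∃ k, k = e * h * e := ⟨_, rfl⟩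
  have hkN : k ∈ N := by rw [hk]; exact mul_mem (mul_mem heN hhN) heN
  have hkα : α k = -k := by rw [hk, map_mul, map_mul, heα, hhα, mul_neg, neg_mul]
  have hks : star k = k := by rw [hk, star_mul, star_mul, hes, hhs, mul_assoc]
  have hek : e * k = k := by rw [hk]; simp only [← mul_assoc, hee]
  have hke : k * e = k := by rw [hk]; simp only [mul_assoc, hee]
  rw [← hk] at hh0
  -- The square of the odd corner element `k` is even, hence a multiple of `e`; the multiple is
  -- positive because `k` is self-adjoint and nonzero.
  obtain ⟨c, hc⟩ := hmin (k * k)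
    (mem_evenSubalgebra.2 ⟨mul_mem hkN hkN, by rw [map_mul, hkα, neg_mul_neg]⟩)
  rw [← mul_assoc, hek, mul_assoc, hke] at hc
  obtain ⟨r, hr, hcr⟩ := Matrix.exists_pos_of_star_mul_self hep hh0 (c := c) (by rw [hks, hc])
  have hr0 : (r : ℂ) ≠ 0 := by exact_mod_cast hr.ne'
  have hττ : ((r : ℂ)⁻¹ • k) * ((r : ℂ)⁻¹ • k) = e := by
    rw [smul_mul_smul_comm, hc, smul_smul, hcr,
      show (r : ℂ)⁻¹ * (r : ℂ)⁻¹ * (r : ℂ) ^ 2 = 1 by field_simp, one_smul]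
  refine ⟨(r : ℂ)⁻¹ • k, Subalgebra.smul_mem _ hkN _, by rw [map_smul, hkα, smul_neg], ?_,
    by rw [mul_smul_comm, hek], by rw [smul_mul_assoc, hke], .inr hττ, ?_⟩
  · rw [star_smul, hks, star_inv₀]; simp
  · intro x hx hxα
    -- Multiplying odd elements by `τ` makes them even, so `τ * (e * x * e) = d • e`. A second
    -- multiplication by `τ` gives `e * x * e = d • τ`.
    obtain ⟨d, hd⟩ := hmin (((r : ℂ)⁻¹ • k) * x)
      (mem_evenSubalgebra.2 ⟨mul_mem (Subalgebra.smul_mem _ hkN _) hx, by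
        rw [map_mul, hxα, map_smul, hkα, smul_neg, neg_mul_neg]⟩)
    have h1 : ((r : ℂ)⁻¹ • k) * (e * x * e) = d • e := by
      rw [← hd]
      simp only [smul_mul_assoc, mul_smul_comm, ← mul_assoc, hek, hke]
    refine ⟨d, ?_⟩
    calc e * x * e = ((r : ℂ)⁻¹ • k) * (((r : ℂ)⁻¹ • k) * (e * x * e)) := by
          rw [← mul_assoc, hττ]; simp only [← mul_assoc, hee]
      _ = d • ((r : ℂ)⁻¹ • k) := by
          rw [h1, mul_smul_comm, smul_mul_assoc, hke]

end MatrixAlgebra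

/-! ### The normal form of an edge projection. -/

section MatrixAlgebra

variable {m : Type*} [Fintype m] [DecidableEq m]

/-- A partition of unity by minimal even projections `e a` of a graded algebra `N` of matrices,
together with self-adjoint odd elements `τ a` such that the corner at `e a` is spanned by `e a` and
`τ a`. -/
structure GradedFamily (α : Matrix m m ℂ ≃⋆ₐ[ℂ] Matrix m m ℂ)
    (N : Subalgebra ℂ (Matrix m m ℂ)) where
  card : ℕ
  e : Fin card → Matrix m m ℂ
  τ : Fin card → Matrix m m ℂ
  e_mem : ∀ a, e a ∈ N
  e_even : ∀ a, α (e a) = e a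
  e_proj : ∀ a, IsStarProjection (e a)
  e_orth : ∀ a b, a ≠ b → e a * e b = 0
  e_sum : ∑ a, e a = 1
  τ_mem : ∀ a, τ a ∈ N
  τ_odd : ∀ a, α (τ a) = -τ a
  τ_star : ∀ a, star (τ a) = τ a
  e_mul_τ : ∀ a, e a * τ a = τ a
  τ_mul_e : ∀ a, τ a * e a = τ a
  τ_sq : ∀ a, τ a = 0 ∨ τ a * τ a = e a
  corner : ∀ a, ∀ x ∈ N, ∃ c d : ℂ, e a * x * e a = c • e a + d • τ a

theorem GradedFamily.nonempty (α : Matrix m m ℂ ≃⋆ₐ[ℂ] Matrix m m ℂ) (hα : ∀ x, α (α x) = x)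
    (N : Subalgebra ℂ (Matrix m m ℂ)) (hN : ∀ x ∈ N, star x ∈ N) (hNα : ∀ x ∈ N, α x ∈ N) :
    Nonempty (GradedFamily α N) := by
  obtain ⟨r, e, he, horth, hsum⟩ := Matrix.exists_minimal_family (evenSubalgebra α N)
    (fun x hx => ⟨hN x hx.1, by
      have : α x = x := hx.2
      change α (star x) = star x
      rw [map_star, this]⟩) 1 (one_mem _) (.one _)
  have hτ := fun a => Matrix.exists_odd_corner α hα N hN hNα (he a).1 (he a).2.1 (he a).2.2
  choose τ h1 h2 h3 h4 h5 h6 h7 using hτ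
  exact ⟨⟨r, e, τ, fun a => (he a).1.1, fun a => (he a).1.2, fun a => (he a).2.1, horth, hsum, h1,
    h2, h3, h4, h5, h6, h7⟩⟩

variable {α : Matrix m m ℂ ≃⋆ₐ[ℂ] Matrix m m ℂ} {N N' : Subalgebra ℂ (Matrix m m ℂ)}

theorem GradedFamily.e_mul_e (E : GradedFamily α N) (a : Fin E.card) : E.e a * E.e a = E.e a :=
  (E.e_proj a).isIdempotentElem.eq

theorem GradedFamily.star_e (E : GradedFamily α N) (a : Fin E.card) : star (E.e a) = E.e a :=
  (E.e_proj a).isSelfAdjoint.star_eq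

/-- The projections onto the two eigenspaces of a self-adjoint `κ` with `κ ^ 2 = h`, or just `h` if
`κ` vanishes. -/
noncomputable def eigenprojection (h κ : Matrix m m ℂ) (s : Bool) : Matrix m m ℂ :=
  if κ = 0 then (if s then h else 0) else (1 / 2 : ℂ) • (h + (if s then (1 : ℂ) else -1) • κ)

section eigenprojection

variable {h κ : Matrix m m ℂ}

theorem eigenprojection_mem {B : Subalgebra ℂ (Matrix m m ℂ)} (hh : h ∈ B) (hκ : κ ∈ B)
    (s : Bool) : eigenprojection h κ s ∈ B := by
  unfold eigenprojection
  split_ifs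
  · exact hh
  · exact zero_mem _
  all_goals exact Subalgebra.smul_mem _ (add_mem hh (Subalgebra.smul_mem _ hκ _)) _

theorem eigenprojection_true_add_false :
    eigenprojection h κ true + eigenprojection h κ false = h := by
  unfold eigenprojection
  by_cases hκ : κ = 0
  · simp [hκ]
  · simp only [hκ, if_false, if_true, Bool.false_eq_true]; module

theorem mul_eigenprojection (hh : h * h = h) (hκ : h * κ = κ) (s : Bool) :
    h * eigenprojection h κ s = eigenprojection h κ s := by
  unfold eigenprojection
  split_ifs
  · exact hh
  · exact mul_zero _
  all_goals rw [mul_smul_comm, mul_add, mul_smul_comm, hh, hκ]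

theorem eigenprojection_mul (hh : h * h = h) (hκ : κ * h = κ) (s : Bool) :
    eigenprojection h κ s * h = eigenprojection h κ s := by
  unfold eigenprojection
  split_ifs
  · exact hh
  · exact zero_mul _
  all_goals rw [smul_mul_assoc, add_mul, smul_mul_assoc, hh, hκ]

theorem exists_mul_eigenprojection (hκ : κ * h = κ) (hsq : κ = 0 ∨ κ * κ = h) (s : Bool) :
    ∃ c : ℂ, κ * eigenprojection h κ s = c • eigenprojection h κ s := by
  by_cases h0 : κ = 0
  · exact ⟨0, by rw [h0, zero_mul, zero_smul]⟩
  · refine ⟨if s then (1 : ℂ) else -1, ?_⟩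
    have hsq := hsq.resolve_left h0
    unfold eigenprojection
    simp only [h0, if_false]
    cases s <;> simp only [if_true, Bool.false_eq_true, if_false, mul_smul_comm, mul_add, hκ, hsq] <;>
      module

theorem isStarProjection_eigenprojection (hh : IsStarProjection h) (hκ : κ * h = κ)
    (hκ' : h * κ = κ) (hκs : star κ = κ) (hsq : κ = 0 ∨ κ * κ = h) (s : Bool) :
    IsStarProjection (eigenprojection h κ s) := by
  have hhh : h * h = h := hh.isIdempotentElem.eq
  unfold eigenprojection
  by_cases h0 : κ = 0
  · cases s
    · simp [h0, IsStarProjection.zero]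
    · simpa [h0] using hh
  · have hsq := hsq.resolve_left h0
    simp only [h0, if_false]
    refine ⟨?_, ?_⟩
    · rw [IsIdempotentElem]
      cases s <;> simp only [if_true, Bool.false_eq_true, if_false, smul_mul_assoc, mul_smul_comm, mul_add,
        add_mul, hκ, hκ', hsq, hhh] <;> module
    · rw [isSelfAdjoint_iff, star_smul, star_add, star_smul, hκs, hh.isSelfAdjoint.star_eq]
      cases s <;> simp

theorem eigenprojection_orth (hhh : h * h = h) (hκ : κ * h = κ)
    (hκ' : h * κ = κ) (hsq : κ = 0 ∨ κ * κ = h) {s t : Bool} (hst : s ≠ t) :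
    eigenprojection h κ s * eigenprojection h κ t = 0 := by
  unfold eigenprojection
  by_cases h0 : κ = 0
  · cases s <;> cases t <;> simp_all
  · have hsq := hsq.resolve_left h0
    simp only [h0, if_false]
    cases s <;> cases t <;> first | exact absurd rfl hst | skip
    all_goals
      simp only [if_true, Bool.false_eq_true, if_false, smul_mul_assoc, mul_smul_comm, mul_add,
        add_mul, hκ, hκ', hsq, hhh]
      module

/-- The corner at `h` is spanned by `h` and `κ`, and both act on an eigenprojection as scalars. -/
theorem isMinimalIn_eigenprojection {B : Subalgebra ℂ (Matrix m m ℂ)} (hhh : h * h = h)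
    (hκ : κ * h = κ) (hκ' : h * κ = κ) (hκs : star κ = κ) (hh : IsStarProjection h)
    (hsq : κ = 0 ∨ κ * κ = h)
    (hB : ∀ x ∈ B, ∃ c d : ℂ, h * x * h = c • h + d • κ) (s : Bool) :
    IsMinimalIn B (eigenprojection h κ s) := by
  intro x hx
  obtain ⟨c, d, hcd⟩ := hB x hx
  obtain ⟨k, hk⟩ := exists_mul_eigenprojection hκ hsq s
  have h1 := mul_eigenprojection hhh hκ' s
  have h2 := eigenprojection_mul hhh hκ s
  have hg := (isStarProjection_eigenprojection hh hκ hκ' hκs hsq s).isIdempotentElem.eq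
  refine ⟨c + d * k, ?_⟩
  calc eigenprojection h κ s * x * eigenprojection h κ s
      = eigenprojection h κ s * (h * x * h) * eigenprojection h κ s := by
        conv_lhs => rw [← h2, mul_assoc, ← h1]
        simp only [mul_assoc, h1]
        simp only [← mul_assoc, h2]
    _ = (c + d * k) • eigenprojection h κ s := by
        rw [hcd, mul_assoc, add_mul, smul_mul_assoc, smul_mul_assoc, h1, hk, mul_add,
          mul_smul_comm, mul_smul_comm, mul_smul_comm, hg]
        module

end eigenprojection

/-- By minimality `P * g = c • g`, and idempotence of `P` forces `c ^ 2 = c` unless `g = 0`. -/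
theorem mul_eq_zero_or_of_commute_minimal {B : Subalgebra ℂ (Matrix m m ℂ)} {P g : Matrix m m ℂ}
    (hP : P ∈ B) (hPP : P * P = P) (hgg : g * g = g) (hmin : IsMinimalIn B g)
    (hc : Commute P g) : P * g = 0 ∨ P * g = g := by
  obtain ⟨c, hcg⟩ := hmin P hP
  rw [← hc.eq, mul_assoc, hgg] at hcg
  have h1 : c • (c • g) = c • g := by
    conv_rhs => rw [← hcg, ← hPP, mul_assoc, hcg, mul_smul_comm, hcg]
  rw [smul_smul, ← sub_eq_zero, ← sub_smul, smul_eq_zero] at h1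
  rcases h1 with h1 | h1
  · have : c * (c - 1) = 0 := by linear_combination h1
    rcases mul_eq_zero.1 this with h2 | h2
    · left; rw [hcg, h2, zero_smul]
    · right; rw [hcg, sub_eq_zero.1 h2, one_smul]
  · left; rw [h1, mul_zero]

/-- The edge unitary: it brings an edge projection to a form that is compatible with given minimal
even projections on the two end points. -/
theorem exists_edge_unitary (hα : ∀ x, α (α x) = x)
    (hN : ∀ x ∈ N, star x ∈ N) (hNα : ∀ x ∈ N, α x ∈ N)
    (hN' : ∀ x ∈ N', star x ∈ N') (hNα' : ∀ x ∈ N', α x ∈ N')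
    (hs : SuperCommute α (N : Set (Matrix m m ℂ)) N')
    (E : GradedFamily α N) (F : GradedFamily α N') {P : Matrix m m ℂ}
    (hP : P ∈ Subalgebra.toSubmodule N * Subalgebra.toSubmodule N') (heven : α P = P)
    (hproj : IsStarProjection P) :
    ∃ U ∈ evenSubalgebra α (N ⊔ N'), U ∈ unitary (Matrix m m ℂ) ∧
      (∀ a, Commute (star U * P * U) (E.e a)) ∧ (∀ b, Commute (star U * P * U) (F.e b)) ∧
      ∀ a b, star U * P * U * (E.e a * F.e b) = 0 ∨
        star U * P * U * (E.e a * F.e b) = E.e a * F.e b ∨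
        (E.τ a * E.τ a = E.e a ∧ F.τ b * F.τ b = F.e b ∧
          (star U * P * U * (E.e a * F.e b) =
              (1 / 2 : ℂ) • (E.e a * F.e b + Complex.I • (E.τ a * F.τ b)) ∨
            star U * P * U * (E.e a * F.e b) =
              (1 / 2 : ℂ) • (E.e a * F.e b + Complex.I • (F.τ b * E.τ a)))) := by
  have hs' : SuperCommute α (N' : Set (Matrix m m ℂ)) N :=
    SuperCommute.symm_of_stable (B := Subalgebra.toSubmodule N) hα hs hNα
  have hE : ∀ a, ∀ y ∈ N', E.e a * y = y * E.e a := fun a y hy =>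
    (hs _ (E.e_mem a) y hy).1 (E.e_even a)
  have hF : ∀ b, ∀ x ∈ N, F.e b * x = x * F.e b := fun b x hx =>
    (hs' _ (F.e_mem b) x hx).1 (F.e_even b)
  have hττ : ∀ a b, E.τ a * F.τ b = -(F.τ b * E.τ a) := fun a b => by
    rw [(hs _ (E.τ_mem a) _ (F.τ_mem b)).2 (E.τ_odd a), F.τ_odd, neg_mul]
  obtain ⟨B, hBdef⟩ : ∃ B, B = evenSubalgebra α (N ⊔ N') := ⟨_, rfl⟩
  have hNB : ∀ x ∈ N, x ∈ N ⊔ N' := fun x hx => (le_sup_left : N ≤ N ⊔ N') hx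
  have hNB' : ∀ x ∈ N', x ∈ N ⊔ N' := fun x hx => (le_sup_right : N' ≤ N ⊔ N') hx
  have hBstar : ∀ x ∈ B, star x ∈ B := by
    rw [hBdef]
    intro x hx
    obtain ⟨hx1, hx2⟩ := mem_evenSubalgebra.1 hx
    refine mem_evenSubalgebra.2 ⟨?_, by rw [map_star, hx2]⟩
    rw [← Algebra.adjoin_eq N, ← Algebra.adjoin_eq N', ← Algebra.adjoin_union] at hx1 ⊢
    refine adjoin_star_mem ?_ x hx1
    rintro z (hz | hz)
    · exact .inl (hN z hz)
    · exact .inr (hN' z hz)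
  have hPB : P ∈ B := by
    rw [hBdef]
    refine mem_evenSubalgebra.2 ⟨?_, heven⟩
    have : Subalgebra.toSubmodule N * Subalgebra.toSubmodule N' ≤
        Subalgebra.toSubmodule (N ⊔ N') := by
      rw [Submodule.mul_le]
      exact fun x hx y hy => mul_mem (S := Subalgebra ℂ (Matrix m m ℂ)) (hNB x hx) (hNB' y hy)
    exact this hP
  set h : Fin E.card → Fin F.card → Matrix m m ℂ := fun a b => E.e a * F.e b with hh
  -- The factors anticommute, so the `i` makes `κ` self-adjoint, with square `h` whenever neither
  -- factor vanishes.
  set κ : Fin E.card → Fin F.card → Matrix m m ℂ := fun a b => Complex.I • (E.τ a * F.τ b)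
    with hκ
  have hhB : ∀ a b, h a b ∈ B := fun a b => by
    rw [hBdef]
    exact mem_evenSubalgebra.2 ⟨mul_mem (hNB _ (E.e_mem a)) (hNB' _ (F.e_mem b)), by
      rw [map_mul, E.e_even, F.e_even]⟩
  have hκB : ∀ a b, κ a b ∈ B := fun a b => by
    rw [hBdef]
    exact mem_evenSubalgebra.2 ⟨Subalgebra.smul_mem _ (mul_mem (hNB _ (E.τ_mem a))
      (hNB' _ (F.τ_mem b))) _, by rw [map_smul, map_mul, E.τ_odd, F.τ_odd, neg_mul_neg]⟩
  have hhh : ∀ a b a' b', h a b * h a' b' = (E.e a * E.e a') * (F.e b * F.e b') := by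
    intro a b a' b'
    simp only [hh]
    rw [mul_assoc, ← mul_assoc (F.e b), hF b _ (E.e_mem a'), mul_assoc (E.e a'), ← mul_assoc]
  have hh1 : ∀ a b, h a b * h a b = h a b := fun a b => by
    rw [hhh, E.e_mul_e, F.e_mul_e]
  have hhp : ∀ a b, IsStarProjection (h a b) := fun a b => ⟨hh1 a b, by
    rw [isSelfAdjoint_iff]
    simp only [hh]
    rw [star_mul, E.star_e, F.star_e, hF b _ (E.e_mem a)]⟩
  have hhκ : ∀ a b, h a b * κ a b = κ a b := fun a b => by
    simp only [hh, hκ]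
    rw [mul_smul_comm, mul_assoc, ← mul_assoc (F.e b), hF b _ (E.τ_mem a), mul_assoc (E.τ a),
      F.e_mul_τ, ← mul_assoc, E.e_mul_τ]
  have hκs : ∀ a b, star (κ a b) = κ a b := fun a b => by
    simp only [hκ]
    rw [star_smul, star_mul, E.τ_star, F.τ_star, hττ a b, smul_neg]
    simp
  have hκh : ∀ a b, κ a b * h a b = κ a b := fun a b => by
    have := congrArg star (hhκ a b)
    rwa [star_mul, hκs, (hhp a b).isSelfAdjoint.star_eq] at this
  have hκsq' : ∀ a b, E.τ a * E.τ a = E.e a → F.τ b * F.τ b = F.e b →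
      κ a b * κ a b = h a b := fun a b h1 h2 => by
    simp only [hκ, hh]
    rw [smul_mul_smul_comm, Complex.I_mul_I, mul_assoc, ← mul_assoc (F.τ b),
      ← neg_eq_iff_eq_neg.2 (hττ a b), neg_mul, mul_neg, mul_assoc (E.τ a), h2, ← mul_assoc, h1]
    simp
  have hτne : ∀ a b, κ a b ≠ 0 → E.τ a * E.τ a = E.e a ∧ F.τ b * F.τ b = F.e b := by
    intro a b hne
    refine ⟨(E.τ_sq a).resolve_left fun h0 => hne ?_, (F.τ_sq b).resolve_left fun h0 => hne ?_⟩ <;>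
      simp [hκ, h0]
  have hκsq : ∀ a b, κ a b = 0 ∨ κ a b * κ a b = h a b := fun a b => by
    by_cases hne : κ a b = 0
    · exact .inl hne
    · exact .inr (hκsq' a b (hτne a b hne).1 (hτne a b hne).2)
  have hcorner : ∀ a b, ∀ x ∈ B, ∃ c d : ℂ, h a b * x * h a b = c • h a b + d • κ a b := by
    intro a b x hx
    rw [hBdef] at hx
    obtain ⟨hx1, hx2⟩ := mem_evenSubalgebra.1 hx
    have hx3 := SuperCommute.sup_le_mul hα hs hNα hNα' hx1
    -- The product of the two corners is spanned by `e f`, `τ τ'` and the mixed terms `e τ'`, `τ f`.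
    -- The mixed terms are odd, so they disappear for even `x`.
    have hform : ∃ c d : ℂ, ∃ z ∈ oddSubmodule α,
        h a b * x * h a b = c • h a b + d • κ a b + z := by
      clear hx hx1 hx2
      induction hx3 using Submodule.mul_induction_on' with
      | mem_mul_mem u hu w hw =>
        obtain ⟨c, d, hcd⟩ := E.corner a u hu
        obtain ⟨c', d', hcd'⟩ := F.corner b w hw
        refine ⟨c * c', -Complex.I * (d * d'), (c * d') • (E.e a * F.τ b) +
          (d * c') • (E.τ a * F.e b), ?_, ?_⟩
        · refine add_mem (Submodule.smul_mem _ _ ?_) (Submodule.smul_mem _ _ ?_) <;>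
            rw [mem_oddSubmodule, map_mul]
          · rw [E.e_even, F.τ_odd, mul_neg]
          · rw [E.τ_odd, F.e_even, neg_mul]
        · have h1 : h a b * (u * w) * h a b = (E.e a * u * E.e a) * (F.e b * w * F.e b) := by
            simp only [hh]
            have e1 := hF b u hu
            have e2 := hE a w hw
            have e3 := hE a (F.e b) (F.e_mem b)
            calc E.e a * F.e b * (u * w) * (E.e a * F.e b)
                = E.e a * (F.e b * u) * (w * E.e a) * F.e b := by simp only [mul_assoc]
              _ = E.e a * u * (F.e b * E.e a) * w * F.e b := by
                rw [e1, ← e2]; simp only [mul_assoc]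
              _ = _ := by rw [← e3]; simp only [mul_assoc]
          rw [h1, hcd, hcd']
          simp only [hh, hκ, add_mul, mul_add, smul_mul_smul_comm, smul_smul]
          have : -Complex.I * (d * d') * Complex.I = d * d' := by
            linear_combination (-(d * d')) * Complex.I_mul_I
          rw [this]
          abel
      | add x hx y hy hx' hy' =>
        obtain ⟨c, d, z, hz, h1⟩ := hx'
        obtain ⟨c', d', z', hz', h2⟩ := hy'
        refine ⟨c + c', d + d', z + z', add_mem hz hz', ?_⟩
        rw [mul_add, add_mul, h1, h2]
        module
    obtain ⟨c, d, z, hz, hcd⟩ := hform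
    refine ⟨c, d, ?_⟩
    have hhα : α (h a b) = h a b := by have := hhB a b; rw [hBdef] at this; exact this.2
    have hκα : α (κ a b) = κ a b := by have := hκB a b; rw [hBdef] at this; exact this.2
    have h2 := congrArg α hcd
    rw [map_mul, map_mul, hhα, hx2, map_add, map_add, map_smul, map_smul, hhα, hκα,
      mem_oddSubmodule.1 hz, hcd] at h2
    have h3 : α z = z := by
      rw [mem_oddSubmodule.1 hz]; exact (add_left_cancel h2).symm
    rw [hcd, eq_zero_of_even_of_odd h3 hz, add_zero]
  -- the orthogonal family of minimal projections of the even algebra of the edge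
  have hgmin : ∀ a b s, IsMinimalIn B (eigenprojection (h a b) (κ a b) s) := fun a b s =>
    isMinimalIn_eigenprojection (hh1 a b) (hκh a b) (hhκ a b) (hκs a b) (hhp a b) (hκsq a b)
      (hcorner a b) s
  have hgp : ∀ a b s, IsStarProjection (eigenprojection (h a b) (κ a b) s) := fun a b s =>
    isStarProjection_eigenprojection (hhp a b) (hκh a b) (hhκ a b) (hκs a b) (hκsq a b) s
  obtain ⟨U, hUB, hU, hUc⟩ := Matrix.exists_unitary_commute B hBstar
    (fun i : (Fin E.card × Fin F.card) × Bool =>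
      eigenprojection (h i.1.1 i.1.2) (κ i.1.1 i.1.2) i.2)
    (fun i => eigenprojection_mem (hhB _ _) (hκB _ _) _) (fun i => hgp _ _ _)
    (fun i => hgmin _ _ _)
    (by
      rintro ⟨⟨a, b⟩, s⟩ ⟨⟨a', b'⟩, s'⟩ hne
      dsimp only
      by_cases hab : (a, b) = (a', b')
      · obtain ⟨rfl, rfl⟩ := Prod.mk.inj hab
        exact eigenprojection_orth (hh1 a b) (hκh a b) (hhκ a b) (hκsq a b)
          (by rintro rfl; exact hne rfl)
      · have h0 : h a b * h a' b' = 0 := by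
          rw [hhh]
          by_cases ha : a = a'
          · have hb : b ≠ b' := by rintro rfl; exact hab (by rw [ha])
            rw [F.e_orth b b' hb, mul_zero]
          · rw [E.e_orth a a' ha, zero_mul]
        rw [← eigenprojection_mul (hh1 a b) (hκh a b) s,
          ← mul_eigenprojection (hh1 a' b') (hhκ a' b') s', mul_assoc, ← mul_assoc (h a b), h0,
          zero_mul, mul_zero])
    hPB hproj Finset.univ
  have hUU : U * star U = 1 := Unitary.mul_star_self_of_mem hU
  obtain ⟨Q, hQ⟩ : ∃ Q, Q = star U * P * U := ⟨_, rfl⟩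
  have hQB : Q ∈ B := by rw [hQ]; exact mul_mem (mul_mem (hBstar U hUB) hPB) hUB
  have hQQ : Q * Q = Q := by
    rw [hQ, mul_assoc, mul_assoc, ← mul_assoc U, ← mul_assoc U, hUU, one_mul,
          ← mul_assoc P, hproj.isIdempotentElem.eq, ← mul_assoc]
  have hQg : ∀ a b s, Commute Q (eigenprojection (h a b) (κ a b) s) := fun a b s => by
    rw [hQ]; exact hUc ((a, b), s) (Finset.mem_univ _)
  have hQh : ∀ a b, Commute Q (h a b) := fun a b => by
    rw [← eigenprojection_true_add_false (h := h a b) (κ := κ a b)]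
    exact (hQg a b true).add_right (hQg a b false)
  rw [hBdef] at hUB
  refine ⟨U, hUB, hU, fun a => ?_, fun b => ?_, fun a b => ?_⟩
  -- `E.e a` is the sum of the `h a b` over `b`, and each of these commutes with `Q`.
  · rw [← hQ, ← mul_one (E.e a), ← F.e_sum, Finset.mul_sum]
    exact Commute.sum_right _ _ _ fun b _ => hQh a b
  · rw [← hQ, ← one_mul (F.e b), ← E.e_sum, Finset.sum_mul]
    exact Commute.sum_right _ _ _ fun a _ => hQh a b
  · rw [← hQ]
    change Q * h a b = 0 ∨ Q * h a b = h a b ∨ _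
    have ht := mul_eq_zero_or_of_commute_minimal hQB hQQ (hgp a b true).isIdempotentElem.eq
      (hgmin a b true) (hQg a b true)
    have hf := mul_eq_zero_or_of_commute_minimal hQB hQQ (hgp a b false).isIdempotentElem.eq
      (hgmin a b false) (hQg a b false)
    have hsum := eigenprojection_true_add_false (h := h a b) (κ := κ a b)
    have hQs : Q * h a b = Q * eigenprojection (h a b) (κ a b) true +
        Q * eigenprojection (h a b) (κ a b) false := by rw [← mul_add, hsum]
    by_cases hne : κ a b = 0
    · have h0 : eigenprojection (h a b) (κ a b) false = 0 := by simp [eigenprojection, hne]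
      rw [h0, add_zero] at hsum
      rw [h0, mul_zero, add_zero, hsum] at hQs
      rw [hsum] at ht
      rcases ht with ht | ht
      · exact .inl ht
      · exact .inr (.inl ht)
    -- `Q` is `0` or `1` on each eigenprojection of `κ`. The mixed cases give `(h ± κ) / 2`, and the
    -- minus sign is absorbed by exchanging the two anticommuting odd factors.
    · rcases ht with ht | ht <;> rcases hf with hf | hf <;> rw [ht, hf] at hQs
      · exact .inl (by rw [hQs, add_zero])
      · refine .inr (.inr ⟨(hτne a b hne).1, (hτne a b hne).2, .inr ?_⟩)
        change Q * h a b = _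
        rw [hQs, zero_add, eigenprojection, if_neg hne]
        simp only [Bool.false_eq_true, if_false, hκ, hττ a b, smul_neg]
        simp [hh]
      · refine .inr (.inr ⟨(hτne a b hne).1, (hτne a b hne).2, .inl ?_⟩)
        change Q * h a b = _
        rw [hQs, add_zero, eigenprojection, if_neg hne]
        simp [hh, hκ]
      · exact .inr (.inl (by rw [hQs, hsum]))

end MatrixAlgebra

/-! ### Joint eigenvectors and ground states. -/

section MatrixAlgebra

variable {m : Type*} [Fintype m] [DecidableEq m]

theorem Matrix.IsHermitian.exists_eigenvalue_eq {H : Matrix m m ℂ} (hH : H.IsHermitian) {t : ℝ}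
    {φ : m → ℂ} (hφ : φ ≠ 0) (h : H *ᵥ φ = (t : ℂ) • φ) : ∃ i, hH.eigenvalues i = t := by
  have hmem : t ∈ spectrum ℝ H := by
    rw [spectrum.mem_iff]
    intro hu
    obtain ⟨W, hW⟩ := hu.exists_left_inv
    refine hφ ?_
    have h0 : (algebraMap ℝ (Matrix m m ℂ) t - H) *ᵥ φ = 0 := by
      rw [Matrix.sub_mulVec, h, Algebra.algebraMap_eq_smul_one, Matrix.smul_mulVec,
        Matrix.one_mulVec]
      ext; simp
    rw [← Matrix.one_mulVec φ, ← hW, ← Matrix.mulVec_mulVec, h0, Matrix.mulVec_zero]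
  rw [hH.spectrum_real_eq_range_eigenvalues] at hmem
  exact hmem

/-- An eigenvector can be chosen in the range of one member of each of several commuting
partitions of unity. -/
theorem Matrix.exists_joint_eigenvector {H : Matrix m m ℂ} {ι : Type*} {r : ι → ℕ}
    (g : ∀ i, Fin (r i) → Matrix m m ℂ) (hsum : ∀ i, ∑ a, g i a = 1)
    (hidem : ∀ i a, g i a * g i a = g i a) (hH : ∀ i a, Commute H (g i a))
    (hg : ∀ i j a b, Commute (g i a) (g j b)) {t : ℂ}
    (hψ : ∃ ψ : m → ℂ, ψ ≠ 0 ∧ H *ᵥ ψ = t • ψ) (s : Finset ι) :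
    ∃ ψ : m → ℂ, ψ ≠ 0 ∧ H *ᵥ ψ = t • ψ ∧ ∀ i ∈ s, ∃ a, g i a *ᵥ ψ = ψ := by
  classical
  induction s using Finset.induction_on with
  | empty => obtain ⟨ψ, h1, h2⟩ := hψ; exact ⟨ψ, h1, h2, by simp⟩
  | insert i s _ ih =>
    obtain ⟨ψ, h1, h2, h3⟩ := ih
    -- The components of `ψ` add up to `ψ`, so one is nonzero. Projecting onto it preserves the
    -- eigenvalue and the earlier choices, because everything commutes.
    obtain ⟨a, ha⟩ : ∃ a, g i a *ᵥ ψ ≠ 0 := by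
      by_contra! hcon
      refine h1 ?_
      rw [← Matrix.one_mulVec ψ, ← hsum i, Matrix.sum_mulVec]
      exact Finset.sum_eq_zero fun a _ => hcon a
    refine ⟨g i a *ᵥ ψ, ha, ?_, fun j hj => ?_⟩
    · rw [Matrix.mulVec_mulVec, (hH i a).eq, ← Matrix.mulVec_mulVec, h2, Matrix.mulVec_smul]
    · rcases Finset.mem_insert.1 hj with rfl | hj
      · exact ⟨a, by rw [Matrix.mulVec_mulVec, hidem]⟩
      · obtain ⟨b, hb⟩ := h3 j hj
        exact ⟨b, by rw [Matrix.mulVec_mulVec, (hg j i b a).eq, ← Matrix.mulVec_mulVec, hb]⟩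

/-- The product of commuting projections. -/
theorem Matrix.exists_prod_projection (B : Subalgebra ℂ (Matrix m m ℂ)) {ι : Type*}
    (x : ι → Matrix m m ℂ) (hx : ∀ i, x i ∈ B) (hxp : ∀ i, IsStarProjection (x i))
    (hxc : ∀ i j, Commute (x i) (x j)) (s : Finset ι) :
    ∃ Q ∈ B, IsStarProjection Q ∧ (∀ i ∈ s, x i * Q = Q) ∧
      (∀ ψ : m → ℂ, (∀ i ∈ s, x i *ᵥ ψ = ψ) → Q *ᵥ ψ = ψ) ∧
      ∀ z, (∀ i, Commute z (x i)) → Commute z Q := by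
  classical
  induction s using Finset.induction_on with
  | empty => exact ⟨1, one_mem _, .one _, by simp, by simp, fun z _ => Commute.one_right z⟩
  | insert a s _ ih =>
    obtain ⟨Q, hQB, hQp, hQ1, hQ2, hQ3⟩ := ih
    have hc : Commute (x a) Q := hQ3 _ (hxc a)
    refine ⟨x a * Q, mul_mem (hx a) hQB, ⟨?_, ?_⟩, fun i hi => ?_, fun ψ hψ => ?_, fun z hz => ?_⟩
    · rw [IsIdempotentElem, mul_assoc, ← mul_assoc Q, ← hc.eq, mul_assoc (x a),
        hQp.isIdempotentElem.eq, ← mul_assoc, (hxp a).isIdempotentElem.eq]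
    · rw [isSelfAdjoint_iff, star_mul, hQp.isSelfAdjoint.star_eq, (hxp a).isSelfAdjoint.star_eq,
        hc.eq]
    · rcases Finset.mem_insert.1 hi with rfl | hi
      · rw [← mul_assoc, (hxp i).isIdempotentElem.eq]
      · rw [← mul_assoc, (hxc i a).eq, mul_assoc, hQ1 i hi]
    · rw [← Matrix.mulVec_mulVec, hQ2 ψ fun i hi => hψ i (Finset.mem_insert_of_mem hi),
        hψ a (Finset.mem_insert_self _ _)]
    · exact (hz a).mul_right (hQ3 z hz)

end MatrixAlgebra

namespace FermionSystem

variable {V : Type*} [Fintype V] [DecidableEq V]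

theorem exists_isGroundState (S : FermionSystem V) {H : S.Op} (hH : H.IsHermitian) :
    ∃ (t : ℝ) (ψ : S.State), ψ ≠ 0 ∧ H *ᵥ ψ = (t : ℂ) • ψ ∧
      ∀ (t' : ℝ) (φ : S.State), φ ≠ 0 → H *ᵥ φ = (t' : ℂ) • φ → t ≤ t' := by
  have : Nonempty S.Config := ⟨(fun v => ⟨0, S.d_pos v⟩, fun _ => false)⟩
  obtain ⟨i, hi⟩ := Finite.exists_min hH.eigenvalues
  refine ⟨hH.eigenvalues i, (hH.eigenvectorBasis i).ofLp, ?_, ?_, ?_⟩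
  · intro h0
    have := hH.eigenvectorBasis.orthonormal.ne_zero i
    exact this (WithLp.ofLp_injective 2 h0)
  · rw [hH.mulVec_eigenvectorBasis]
    ext; simp
  · intro t' φ hφ h
    obtain ⟨j, rfl⟩ := hH.exists_eigenvalue_eq hφ h
    exact hi j

end FermionSystem

/-! ### Assembly of the edge unitaries, site projections and Majorana operators. -/

open FermionSystem in
theorem mainTheorem8 {V : Type*} [Fintype V] [DecidableEq V] (S : FermionSystem V)
    (G : SimpleGraph V) [Fintype G.edgeSet] (P : G.edgeSet → S.Op)
    (hproj : ∀ e, IsStarProjection (P e))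
    (hsupp : ∀ e, P e ∈ S.localAlgebra (FermionSystem.ends e))
    (heven : ∀ e, S.IsEven (P e))
    (hcomm : ∀ e f, Commute (P e) (P f)) :
    ∃ (U : G.edgeSet → S.Op) (Q : V → S.Op),
      (∀ e, U e ∈ Matrix.unitaryGroup S.Config ℂ ∧
        U e ∈ S.localAlgebra (FermionSystem.ends e) ∧ S.IsEven (U e)) ∧
      (∀ i, IsStarProjection (Q i) ∧ Q i ∈ S.localAlgebra {i} ∧ S.IsEven (Q i)) ∧
      -- first property
      (∀ e f, Commute (U e) (U f)) ∧
      (∀ e f, e ≠ f → Commute (U e) (P f)) ∧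
      -- second property
      (∀ i, Commute (∑ e, (U e)ᴴ * P e * U e) (Q i)) ∧
      -- third property
      (∃ ψ ∈ S.plusEigenspace Q, S.IsGroundState (∑ e, (U e)ᴴ * P e * U e) ψ) ∧
      -- `M` consists of the edges `{i, j}` on which the two operators `τ i j` (at the site `j`)
      -- and `τ j i` (at the site `i`) exist
      ∃ (M : SimpleGraph V) (τ : V → V → S.Op),
        M ≤ G ∧
        (∀ i j, M.Adj i j →
          τ i j ∈ S.localAlgebra {j} ∧ S.IsOdd (τ i j) ∧ (τ i j).IsHermitian ∧
          Q j * τ i j = τ i j ∧ τ i j * Q j = τ i j ∧ τ i j * τ i j = Q j) ∧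
        (∀ i j k l, M.Adj i j → M.Adj k l → (i, j) ≠ (k, l) →
          τ i j * τ k l + τ k l * τ i j = 0) ∧
        ∀ e : G.edgeSet,
          ((e : Sym2 V) ∉ M.edgeSet ∧
            ((∀ ψ ∈ S.plusEigenspace Q, ((U e)ᴴ * P e * U e) *ᵥ ψ = 0) ∨
              (∀ ψ ∈ S.plusEigenspace Q, ((U e)ᴴ * P e * U e) *ᵥ ψ = ψ))) ∨
          (∃ i j, M.Adj i j ∧ (e : Sym2 V) = s(i, j) ∧
            ∀ ψ ∈ S.plusEigenspace Q, ((U e)ᴴ * P e * U e) *ᵥ ψ =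
              (1 / 2 : ℂ) • (ψ + Complex.I • ((τ j i * τ i j) *ᵥ ψ))) := by
  classical
  simp only [← Matrix.star_eq_conjTranspose]
  have heven' : ∀ e, S.grading (P e) = P e := fun e => (S.isEven_iff _).1 (heven e)
  obtain ⟨p, q, N, hpq, hne, hNS, hNα, hNstar, hNN, hPN⟩ := S.exists_site_algebras G P
    (fun e => (hproj e).isSelfAdjoint.star_eq) hsupp heven' hcomm
  have hfam : ∀ i : G.edgeSet × V, Nonempty (GradedFamily S.grading (N i.1 i.2)) := fun i =>
    GradedFamily.nonempty _ S.grading_grading _ (hNstar i.1 i.2) (hNα i.1 i.2)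
  have E := fun i => (hfam i).some
  have hpq' : ∀ e, (e, p e) ≠ (e, q e) := fun e h => hne e (Prod.mk.inj h).2
  have hU := fun e => exists_edge_unitary S.grading_grading (hNstar e (p e)) (hNα e (p e))
    (hNstar e (q e)) (hNα e (q e)) (hNN e (p e) e (q e) (hpq' e)) (E (e, p e)) (E (e, q e))
    (hPN e) (heven' e) (hproj e)
  choose U hUB hUu hUp hUq hUform using hU
  obtain ⟨W, hW⟩ : ∃ W : G.edgeSet → S.Op, ∀ e, W e = star (U e) * P e * U e := ⟨_, fun _ => rfl⟩
  simp only [← hW] at hUp hUq hUform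
  -- commutation of the algebras of different edges
  have hBN : ∀ e f w, (e, p e) ≠ (f, w) → (e, q e) ≠ (f, w) →
      ∀ x ∈ evenSubalgebra S.grading (N e (p e) ⊔ N e (q e)), ∀ y ∈ N f w, Commute x y := by
    intro e f w h1 h2 x hx y hy
    have h3 : SuperCommute S.grading (N f w : Set S.Op)
        (N e (p e) ∪ N e (q e) : Set S.Op) := by
      rintro y hy x (hx | hx)
      · exact hNN f w e (p e) h1.symm y hy x hx
      · exact hNN f w e (q e) h2.symm y hy x hx
    have h4 := h3.adjoin_right
    rw [Algebra.adjoin_union, Algebra.adjoin_eq, Algebra.adjoin_eq] at h4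
    exact (SuperCommute.symm_of_stable (B := Subalgebra.toSubmodule (N f w)) S.grading_grading h4
      (hNα f w) x hx.1 y hy).1 hx.2
  have hBB : ∀ e f, e ≠ f →
      ∀ x ∈ evenSubalgebra S.grading (N e (p e) ⊔ N e (q e)),
      ∀ y ∈ N f (p f) ⊔ N f (q f), Commute x y := by
    intro e f hef x hx y hy
    have hne' : ∀ v w : V, (e, v) ≠ (f, w) := fun v w h => hef (Prod.mk.inj h).1
    have hle : N f (p f) ⊔ N f (q f) ≤ Subalgebra.centralizer ℂ {x} := by
      refine sup_le ?_ ?_ <;> intro z hz <;> rw [Subalgebra.mem_centralizer_iff] <;>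
        rintro _ rfl
      · exact hBN e f _ (hne' _ _) (hne' _ _) _ hx z hz
      · exact hBN e f _ (hne' _ _) (hne' _ _) _ hx z hz
    exact (Subalgebra.mem_centralizer_iff ℂ).1 (hle hy) x rfl
  have hPsup : ∀ e, P e ∈ N e (p e) ⊔ N e (q e) := fun e =>
    Subalgebra.mul_toSubmodule_le _ _ (hPN e)
  have hPB : ∀ e, P e ∈ evenSubalgebra S.grading (N e (p e) ⊔ N e (q e)) := fun e =>
    ⟨hPsup e, heven' e⟩
  have hUP : ∀ e f, e ≠ f → Commute (U e) (P f) := fun e f h => hBB e f h _ (hUB e) _ (hPsup f)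
  have hUU : ∀ e f, Commute (U e) (U f) := fun e f => by
    rcases eq_or_ne e f with rfl | h
    · exact Commute.refl _
    · exact hBB e f h _ (hUB e) _ (hUB f).1
  have hWs : ∀ e, star (W e) = W e := fun e => by
    rw [hW, star_mul, star_mul, star_star, (hproj e).isSelfAdjoint.star_eq, mul_assoc]
  -- the projections at the sites
  have hee : ∀ i j a b, Commute ((E i).e a) ((E j).e b) := by
    intro i j a b
    by_cases hij : i = j
    · subst hij
      by_cases hab : a = b
      · subst hab; exact Commute.refl _
      · rw [Commute, SemiconjBy, (E i).e_orth _ _ hab, (E i).e_orth _ _ (Ne.symm hab)]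
    · exact (hNN i.1 i.2 j.1 j.2 hij _ ((E i).e_mem a) _ ((E j).e_mem b)).1 ((E i).e_even a)
  -- For the two pairs belonging to `e` this was arranged by the choice of `U e`. For any other
  -- pair, `W e` is made of even elements of an algebra that supercommutes with `N i.1 i.2`.
  have hWe : ∀ e i a, Commute (W e) ((E i).e a) := by
    intro e i a
    by_cases h1 : (e, p e) = i
    · subst h1; exact hUp e a
    by_cases h2 : (e, q e) = i
    · subst h2; exact hUq e a
    have h3 : ∀ x ∈ evenSubalgebra S.grading (N e (p e) ⊔ N e (q e)),
        Commute x ((E i).e a) := fun x hx => hBN e i.1 i.2 h1 h2 x hx _ ((E i).e_mem a)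
    have h4 : Commute (star (U e)) ((E i).e a) := by
      have := congrArg star (h3 _ (hUB e)).eq
      rw [star_mul, star_mul, (E i).star_e] at this
      exact this.symm
    rw [hW]
    exact (h4.mul_left (h3 _ (hPB e))).mul_left (h3 _ (hUB e))
  have hHe : ∀ i a, Commute (∑ e, W e) ((E i).e a) := fun i a =>
    Commute.sum_left _ _ _ fun e _ => hWe e i a
  have hHs : (∑ e, W e).IsHermitian := by
    change star (∑ e, W e) = _
    rw [star_sum]
    exact Finset.sum_congr rfl fun e _ => hWs e
  obtain ⟨t, ψ₀, hψ₀, hψ₀t, hmin⟩ := S.exists_isGroundState hHs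
  -- This ground state selects one projection for every pair of an edge and a site; these choices
  -- define `D`, `T` and `Q`.
  obtain ⟨ψ, hψ0, hψt, hψ⟩ := Matrix.exists_joint_eigenvector (fun i a => (E i).e a)
    (fun i => (E i).e_sum) (fun i a => (E i).e_mul_e a) hHe hee ⟨ψ₀, hψ₀, hψ₀t⟩ Finset.univ
  have hψ' : ∀ i, ∃ a, (E i).e a *ᵥ ψ = ψ := fun i => hψ i (Finset.mem_univ i)
  choose a ha using hψ'
  obtain ⟨D, hD⟩ : ∃ D : G.edgeSet → V → S.Op, ∀ e v, D e v = (E (e, v)).e (a (e, v)) :=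
    ⟨_, fun _ _ => rfl⟩
  obtain ⟨T, hT⟩ : ∃ T : G.edgeSet → V → S.Op, ∀ e v, T e v = (E (e, v)).τ (a (e, v)) :=
    ⟨_, fun _ _ => rfl⟩
  have hQ := fun v => Matrix.exists_prod_projection
    (evenSubalgebra S.grading (S.localAlgebra {v})) (fun e => D e v)
    (fun e => by
      rw [hD]; exact ⟨hNS _ _ ((E (e, v)).e_mem _), (E (e, v)).e_even _⟩)
    (fun e => by rw [hD]; exact (E (e, v)).e_proj _)
    (fun e f => by rw [hD, hD]; exact hee _ _ _ _) Finset.univ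
  choose Q hQB hQp hDQ hQψ hQc using hQ
  have hDQ : ∀ e v, D e v * Q v = Q v := fun e v => hDQ v e (Finset.mem_univ e)
  have hQQ : ∀ v, Q v * Q v = Q v := fun v => (hQp v).isIdempotentElem.eq
  have hDs : ∀ e v, star (D e v) = D e v := fun e v => by rw [hD]; exact (E _).star_e _
  have hQD : ∀ e v, Q v * D e v = Q v := fun e v => by
    have := congrArg star (hDQ e v)
    rwa [star_mul, hDs, (hQp v).isSelfAdjoint.star_eq] at this
  have hTodd : ∀ e v, S.grading (T e v) = -T e v := fun e v => by rw [hT]; exact (E _).τ_odd _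
  have hTs : ∀ e v, star (T e v) = T e v := fun e v => by rw [hT]; exact (E _).τ_star _
  have hTmem : ∀ e v, T e v ∈ N e v := fun e v => by rw [hT]; exact (E (e, v)).τ_mem _
  have hTD : ∀ e v f w, Commute (T e v) (D f w) := by
    intro e v f w
    by_cases h : (f, w) = (e, v)
    · obtain ⟨rfl, rfl⟩ := Prod.mk.inj h
      rw [Commute, SemiconjBy, hT, hD, (E _).τ_mul_e, (E _).e_mul_τ]
    · rw [hD]
      exact ((hNN f w e v h _ ((E (f, w)).e_mem _) _ (hTmem e v)).1 ((E (f, w)).e_even _)).symm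
  have hTQ : ∀ e v w, Commute (T e v) (Q w) := fun e v w => hQc w _ fun f => hTD e v f w
  have hQQc : ∀ v w, Commute (Q v) (Q w) := fun v w => hQc w _ fun f => by
    refine (hQc v _ fun f' => ?_).symm
    rw [hD, hD]; exact hee _ _ _ _
  have hTT : ∀ e v f w, (e, v) ≠ (f, w) → T e v * T f w = -(T f w * T e v) := by
    intro e v f w h
    rw [(hNN e v f w h _ (hTmem e v) _ (hTmem f w)).2 (hTodd e v), hTodd, neg_mul]
  have hDψ : ∀ φ ∈ S.plusEigenspace Q, ∀ e v, D e v *ᵥ φ = φ := by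
    intro φ hφ e v
    have h1 : Q v *ᵥ φ = φ := hφ v
    rw [← h1, Matrix.mulVec_mulVec, hDQ]
  have hWψ : ∀ φ ∈ S.plusEigenspace Q, ∀ e,
      W e *ᵥ φ = (W e * (D e (p e) * D e (q e))) *ᵥ φ := by
    intro φ hφ e
    rw [← Matrix.mulVec_mulVec, ← Matrix.mulVec_mulVec, hDψ φ hφ, hDψ φ hφ]
  obtain ⟨maj, hmaj⟩ : ∃ maj : G.edgeSet → Prop, ∀ e, maj e ↔
      (T e (p e) * T e (p e) = D e (p e) ∧ T e (q e) * T e (q e) = D e (q e) ∧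
        (W e * (D e (p e) * D e (q e)) =
            (1 / 2 : ℂ) • (D e (p e) * D e (q e) + Complex.I • (T e (p e) * T e (q e))) ∨
          W e * (D e (p e) * D e (q e)) =
            (1 / 2 : ℂ) • (D e (p e) * D e (q e) + Complex.I • (T e (q e) * T e (p e))))) :=
    ⟨_, fun _ => Iff.rfl⟩
  have hform : ∀ e, W e * (D e (p e) * D e (q e)) = 0 ∨
      W e * (D e (p e) * D e (q e)) = D e (p e) * D e (q e) ∨ maj e := by
    intro e
    rw [hmaj]
    simp only [hD, hT]
    exact hUform e (a (e, p e)) (a (e, q e))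
  let M : SimpleGraph V :=
    { Adj := fun i j => ∃ e : G.edgeSet, maj e ∧ (e : Sym2 V) = s(i, j)
      symm := ⟨fun i j ⟨e, h1, h2⟩ => ⟨e, h1, h2.trans Sym2.eq_swap⟩⟩
      loopless := ⟨fun i ⟨e, _, h2⟩ => by
        have := e.2
        rw [h2] at this
        exact G.ne_of_adj this rfl⟩ }
  have hMadj : ∀ i j, M.Adj i j ↔ ∃ e : G.edgeSet, maj e ∧ (e : Sym2 V) = s(i, j) :=
    fun i j => Iff.rfl
  -- Only the projection `D e j` is the square of `T e j`; cutting down by the smaller `Q j` gives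
  -- an operator with square `Q j`. The value `0` off the edges of `G` is never used.
  obtain ⟨τ, hτ⟩ : ∃ τ : V → V → S.Op, ∀ (e : G.edgeSet) (i j : V), (e : Sym2 V) = s(i, j) →
      τ i j = Q j * T e j := by
    refine ⟨fun i j => if h : s(i, j) ∈ G.edgeSet then Q j * T ⟨_, h⟩ j else 0, ?_⟩
    rintro ⟨e, he⟩ i j rfl
    exact dif_pos he
  have hsq : ∀ e, maj e → ∀ i j, (e : Sym2 V) = s(i, j) → T e j * T e j = D e j := by
    intro e he i j hij
    obtain ⟨h1, h2, _⟩ := (hmaj e).1 he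
    rcases Sym2.eq_iff.1 ((hpq e).symm.trans hij) with ⟨rfl, rfl⟩ | ⟨rfl, rfl⟩
    · exact h2
    · exact h1
  have hlocal : ∀ e : G.edgeSet, N e (p e) ⊔ N e (q e) ≤ S.localAlgebra (ends e) := by
    intro e
    refine sup_le ((hNS e _).trans (S.localAlgebra_mono ?_))
      ((hNS e _).trans (S.localAlgebra_mono ?_)) <;>
      rw [Set.singleton_subset_iff] <;> simp [ends, hpq e]
  have hττψ : ∀ (e : G.edgeSet) (i j : V), (e : Sym2 V) = s(i, j) → ∀ φ ∈ S.plusEigenspace Q,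
      (τ j i * τ i j) *ᵥ φ = (T e i * T e j) *ᵥ φ := by
    intro e i j hij φ hφ
    have hi : Q i *ᵥ φ = φ := hφ i
    have hj : Q j *ᵥ φ = φ := hφ j
    have h1 : τ j i * τ i j = T e i * T e j * (Q i * Q j) := by
      rw [hτ e i j hij, hτ e j i (hij.trans Sym2.eq_swap), ← (hTQ e i i).eq, ← (hTQ e j j).eq,
        mul_assoc, ← mul_assoc (Q i), ← (hTQ e j i).eq]
      simp only [mul_assoc]
    rw [h1, ← Matrix.mulVec_mulVec, ← Matrix.mulVec_mulVec φ (Q i), hj, hi]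
  refine ⟨U, Q, ?_⟩
  simp only [← hW]
  refine ⟨fun e => ⟨hUu e, hlocal e (hUB e).1, (S.isEven_iff _).2 (hUB e).2⟩,
    fun i => ⟨hQp i, (hQB i).1, (S.isEven_iff _).2 (hQB i).2⟩, hUU, hUP, ?_, ?_, M, τ, ?_, ?_, ?_,
    ?_⟩
  · intro i
    exact hQc i _ fun e => by rw [hD]; exact hHe _ _
  · refine ⟨ψ, fun i => hQψ i ψ fun e _ => ?_, hψ0, t, hψt, hmin⟩
    rw [hD]; exact ha _
  · intro i j hij
    obtain ⟨e, _, he⟩ := (hMadj i j).1 hij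
    have := e.2
    rwa [he] at this
  · intro i j hij
    obtain ⟨e, he, hij⟩ := (hMadj i j).1 hij
    rw [hτ e i j hij]
    refine ⟨mul_mem (hQB j).1 (hNS e j (hTmem e j)), ?_, ?_, ?_, ?_, ?_⟩
    · rw [S.isOdd_iff, map_mul, hTodd, mul_neg, (hQB j).2]
    · change star _ = _
      rw [star_mul, hTs, (hQp j).isSelfAdjoint.star_eq, (hTQ e j j).eq]
    · rw [← mul_assoc, hQQ]
    · rw [mul_assoc, (hTQ e j j).eq, ← mul_assoc, hQQ]
    · rw [mul_assoc, ← mul_assoc (T e j), (hTQ e j j).eq, mul_assoc (Q j), hsq e he i j hij,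
        ← mul_assoc, hQQ, hQD]
  · intro i j k l hij hkl hne'
    obtain ⟨e, he, hij⟩ := (hMadj i j).1 hij
    obtain ⟨f, hf, hkl⟩ := (hMadj k l).1 hkl
    have hef : (e, j) ≠ (f, l) := by
      intro h
      obtain ⟨rfl, rfl⟩ := Prod.mk.inj h
      exact hne' (by rw [Sym2.congr_left.1 (hij.symm.trans hkl)])
    have h1 : Q j * T e j * (Q l * T f l) = (Q j * Q l) * (T e j * T f l) := by
      rw [mul_assoc, ← mul_assoc (T e j), (hTQ e j l).eq]; simp only [mul_assoc]
    have h2 : Q l * T f l * (Q j * T e j) = (Q j * Q l) * (T f l * T e j) := by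
      rw [(hQQc j l).eq, mul_assoc, ← mul_assoc (T f l), (hTQ f l j).eq]; simp only [mul_assoc]
    rw [hτ e i j hij, hτ f k l hkl, h1, h2, hTT e j f l hef, ← mul_add, neg_add_cancel, mul_zero]
  · intro e
    by_cases he : maj e
    · right
      -- The sign in front of `κ` decides the order in which the two end points are named.
      rcases ((hmaj e).1 he).2.2 with h | h
      · refine ⟨p e, q e, (hMadj _ _).2 ⟨e, he, hpq e⟩, hpq e, fun φ hφ => ?_⟩
        rw [hWψ φ hφ, h, hττψ e _ _ (hpq e) φ hφ, Matrix.smul_mulVec, Matrix.add_mulVec,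
          Matrix.smul_mulVec, ← Matrix.mulVec_mulVec, hDψ φ hφ, hDψ φ hφ]
      · have hqp := (hpq e).trans Sym2.eq_swap
        refine ⟨q e, p e, (hMadj _ _).2 ⟨e, he, hqp⟩, hqp, fun φ hφ => ?_⟩
        rw [hWψ φ hφ, h, hττψ e _ _ hqp φ hφ, Matrix.smul_mulVec, Matrix.add_mulVec,
          Matrix.smul_mulVec, ← Matrix.mulVec_mulVec, hDψ φ hφ, hDψ φ hφ]
    · left
      refine ⟨fun hmem => he ?_, ?_⟩
      · rw [hpq e, SimpleGraph.mem_edgeSet] at hmem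
        obtain ⟨f, hf, hfe⟩ := (hMadj _ _).1 hmem
        rwa [← Subtype.ext (hfe.trans (hpq e).symm)]
      · rcases hform e with h | h | h
        · left
          intro φ hφ
          rw [hWψ φ hφ, h, Matrix.zero_mulVec]
        · right
          intro φ hφ
          rw [hWψ φ hφ, h, ← Matrix.mulVec_mulVec, hDψ φ hφ, hDψ φ hφ]
        · exact absurd h he
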